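/- Let $(\Omega,\mathcal F,\mathbb P)$ be a probability space and let $T=(T_i)_{i\ge 1}$ be a sequence of independent $[0,\infty]$-valued random variables such that $T_2,T_3,\dots$ are identically distributed. Put $S_n=\sum_{i=1}^nT_i$ for $n\ge 1$, and let $N_t=\sum_{n\ge 1}\mathbf 1(S_n\le t)$, $t\in[0,\infty)$, be the associated renewal process (delay, defect and multiple simultaneous arrivals are allowed). Let $p\in(0,1)$ and let $X=(X_i)_{i\ge 1}$ be an i.i.d. sequence of $\{0,1\}$-valued random variables with $\mathbb P(X_1=1)=p$, independent of $T$. For $i\in\{0,1\}$ let $N^i_t=\sum_{n\ge1}\mathbf 1(S_n\le t,\,X_n=i)$ for $t\in[0,\infty)$, and let $R_i=\inf\{t\in[0,\infty):N^i_t\ge 1\}$ (with $\inf\emptyset=\infty$) be the first renewal epoch of $N^i$. Call $T_2$ non-arithmetic if there is no $\alpha\in(0,\infty)$ with $\mathbb P(T_2\in\{\alpha n:n\in\mathbb N_0\cup\{\infty\}\})=1$. For $\theta\in(0,\infty)$ write $N\sim\mathrm{HPP}(\theta)$ if $N$ is a homogeneous Poisson process of intensity $\theta$, i.e. an $\mathbb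 N_0\cup\{\infty\}$-valued process with right-continuous nondecreasing paths that is a.s. finite, has a.s. only jumps of size $1$, satisfies $N_0=0$ a.s., and has independent increments with $(N_t-N_s)\mathbf 1(N_s<\infty)\sim\mathrm{Pois}(\theta(t-s))$ for $0\le s\le t$. **Theorem 1.1.** (i) Assume $\mathbb P(T_1<\epsilon)>0$ for all $\epsilon>0$, and that either $T_2$ is non-arithmetic or $\mathbb P(T_1=0)=0$ (or both). Then $R_0$ and $R_1$ are independent if and only if $N\sim\mathrm{HPP}(\theta)$ for some $\theta\in(0,\infty)$. (ii) Assume, instead of the conditions in (i), that $N$ is ordinary: $T_1$ has the same law as $T_2$, and for every $i$, $\mathbb P(T_i=\infty)=0$ and $\mathbb P(T_i=0)=0$. Then again $R_0$ and $R_1$ are independent if and only if $N\sim\mathrm{HPP}(\theta)$ for some $\theta\in(0,\infty)$. -/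

import Mathlib

open MeasureTheory ProbabilityTheory Set
open scoped NNReal ENNReal

noncomputable section

namespace MarkedRenewal

variable {Ω : Type*} [MeasurableSpace Ω]

/-- The arrival times. All sequences are indexed from `0` rather than from `1`: `T 0` is the
first (possibly delayed) waiting time, `T 1, T 2, …` are the subsequent ones, and
`arrival T n = T 0 + ⋯ + T n` is the time of the `(n+1)`-st arrival. -/
def arrival (T : ℕ → Ω → ℝ≥0∞) (n : ℕ) (ω : Ω) : ℝ≥0∞ :=
  ∑ i ∈ Finset.range (n + 1), T i ω

/-- The renewal process `N_t = ∑ₙ 𝟙(Sₙ ≤ t)`: the number (possibly `∞`) of arrivals in `[0,t]`,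
counted with multiplicity. -/
def renewalProcess (T : ℕ → Ω → ℝ≥0∞) (t : ℝ≥0) (ω : Ω) : ℕ∞ :=
  {n : ℕ | arrival T n ω ≤ (t : ℝ≥0∞)}.encard

/-- The marked process `N^i_t = ∑ₙ 𝟙(Sₙ ≤ t, Xₙ = i)`, for a mark `i ∈ {0, 1}`. -/
def markedProcess (T : ℕ → Ω → ℝ≥0∞) (X : ℕ → Ω → Fin 2) (i : Fin 2) (t : ℝ≥0) (ω : Ω) : ℕ∞ :=
  {n : ℕ | arrival T n ω ≤ (t : ℝ≥0∞) ∧ X n ω = i}.encard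

/-- The first renewal epoch `R_i = inf {t ∈ [0,∞) : N^i_t ≥ 1}`, with `inf ∅ = ∞`. -/
def firstEpoch (T : ℕ → Ω → ℝ≥0∞) (X : ℕ → Ω → Fin 2) (i : Fin 2) (ω : Ω) : ℝ≥0∞ :=
  ⨅ (t : ℝ≥0) (_ : 1 ≤ markedProcess T X i t ω), (t : ℝ≥0∞)

/-- `Y` is non-arithmetic: there is no `α ∈ (0,∞)` such that
`Y ∈ {α n : n ∈ ℕ₀ ∪ {∞}}` almost surely. -/
def NonArithmetic (Y : Ω → ℝ≥0∞) (P : Measure Ω) : Prop :=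
  ¬ ∃ α : ℝ≥0, 0 < α ∧ P {ω | ∃ n : ℕ∞, Y ω = (α : ℝ≥0∞) * (n : ℝ≥0∞)} = 1

/-- The renewal process with waiting times `T` is ordinary. -/
structure IsOrdinary (T : ℕ → Ω → ℝ≥0∞) (P : Measure Ω) : Prop where
  non_delayed : IdentDistrib (T 0) (T 1) P P
  non_defective : ∀ i, P {ω | T i ω = ∞} = 0
  no_simultaneous_arrivals : ∀ i, P {ω | T i ω = 0} = 0

/-- `N` is a homogeneous Poisson process of intensity `θ ∈ (0,∞)` under `P`. Subtraction on `ℕ∞`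
is truncated with `∞ - n = ∞` for finite `n` and `a - ∞ = 0`, so that `N t - N s` is the
increment `(N_t - N_s) 𝟙(N_s < ∞)` for `s ≤ t`. -/
structure IsHPP (N : ℝ≥0 → Ω → ℕ∞) (θ : ℝ≥0) (P : Measure Ω) : Prop where
  intensity_pos : 0 < θ
  measurable : ∀ t, Measurable (N t)
  monotone : ∀ ω, Monotone fun t => N t ω
  right_continuous : ∀ ω t, ContinuousWithinAt (fun s => N s ω) (Ici t) t
  finite : ∀ᵐ ω ∂P, ∀ t, N t ω < ⊤
  jumps : ∀ᵐ ω ∂P, ∀ t, N t ω - Function.leftLim (fun s => N s ω) t ≤ 1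
  start_zero : ∀ᵐ ω ∂P, N 0 ω = 0
  indep_increments : HasIndepIncrements N P
  poisson_increments : ∀ s t : ℝ≥0, s ≤ t →
    HasLaw (fun ω => N t ω - N s ω)
      ((poissonMeasure (θ * (t - s))).map (fun k : ℕ => (k : ℕ∞))) P

end MarkedRenewal

end

/-! Everything is read off from Laplace transforms at natural numbers. The map x ↦ e^{-x} embeds
[0,∞] in [0,1], so these are moments of a law on [0,1]; they determine laws and detect independence
(`ext_of_lintegral_expNeg_pow`, `indepFun_iff_lintegral_expNeg_pow`). Almost surely the marks begin
with a run of one mark ended by the other; then one first epoch is the first arrival and the other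
is a later arrival. Summing geometric series over the run length, with l0 and l the transforms of `T
0` and `T 1`, independence becomes l0(a+b) (l(a) + l(b) - l(a) l(b)) = l0(a) l0(b) for all a, b, in
which p no longer occurs (`indepFun_firstEpoch_iff`).

If l0 = l > 0, this says that 1/l - 1 is additive, so l(n) = θ/(θ+n) unless l is constant: the
exponential law. In the ordinary case l0 = l is given. In case (i), fix a and let b → ∞: the weight
e^{-b T 0} concentrates near 0, so l0(a+b)/l0(b) → 1, whence l0 = 1 - (1-m)(1-l) with m = P(T 1 = 0)
(`laplace_eq_of_functional_eq`). It remains to see that m = 0. If `T 0` has no atom at 0, the limit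
n → ∞ of this relation shows it. Otherwise `T 1` is non-arithmetic: m = 1 is then excluded at once,
and 0 < m < 1 would force `T 0` to be geometric on a lattice, with `T 1` on the same lattice
(`not_nonArithmetic_of_functional_eq`).

Finally, N is a homogeneous Poisson process exactly when `T 0` and `T 1` are exponential with the
same rate (`exists_isHPP_iff`). One direction is the Markov property at fixed times
(`expSeq_count_eq_and_after_mem`); the other recovers the laws of the arrival times from the
one-dimensional marginals of N. -/

noncomputable section

namespace MarkedRenewal

/-! ### Laplace transforms at natural numbers determine laws and independence. -/

/-- The function `x ↦ e^{-x}` on `[0,∞]`. -/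
def expNeg (x : ℝ≥0∞) : ℝ≥0∞ := (EReal.exp (x : EReal))⁻¹

lemma measurable_expNeg : Measurable expNeg := by
  unfold expNeg; fun_prop

lemma expNeg_zero : expNeg 0 = 1 := by simp [expNeg]

lemma expNeg_top : expNeg ∞ = 0 := by simp [expNeg]

lemma one_le_exp_coe (x : ℝ≥0∞) : 1 ≤ EReal.exp (x : EReal) :=
  EReal.one_le_exp_iff.2 (EReal.coe_ennreal_nonneg x)

lemma expNeg_le_one (x : ℝ≥0∞) : expNeg x ≤ 1 :=
  ENNReal.inv_le_one.2 (one_le_exp_coe x)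

lemma expNeg_ne_top (x : ℝ≥0∞) : expNeg x ≠ ∞ := ((expNeg_le_one x).trans_lt ENNReal.one_lt_top).ne

lemma expNeg_add (x y : ℝ≥0∞) : expNeg (x + y) = expNeg x * expNeg y := by
  have hx : EReal.exp (x : EReal) ≠ 0 := (zero_lt_one.trans_le (one_le_exp_coe x)).ne'
  have hy : EReal.exp (y : EReal) ≠ 0 := (zero_lt_one.trans_le (one_le_exp_coe y)).ne'
  rw [expNeg, EReal.coe_ennreal_add, EReal.exp_add, ENNReal.mul_inv (Or.inl hx) (Or.inr hy)]
  rfl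

lemma expNeg_sum {ι : Type*} (s : Finset ι) (f : ι → ℝ≥0∞) :
    expNeg (∑ i ∈ s, f i) = ∏ i ∈ s, expNeg (f i) := by
  classical
  induction s using Finset.induction_on with
  | empty => simp [expNeg_zero]
  | insert a s ha ih => rw [Finset.sum_insert ha, Finset.prod_insert ha, expNeg_add, ih]

lemma expNeg_strictAnti : StrictAnti expNeg := fun x y h => by
  simpa [expNeg] using h

lemma expNeg_coe (x : ℝ≥0) : expNeg x = ENNReal.ofReal (Real.exp (-(x : ℝ))) := by
  have : ((x : ℝ≥0∞) : EReal) = ((x : ℝ) : EReal) := rfl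
  rw [expNeg, this, EReal.exp_coe, Real.exp_neg, ENNReal.ofReal_inv_of_pos (Real.exp_pos _)]

lemma exists_expNeg_eq {r : ℝ≥0} (hr : r ≤ 1) : ∃ x, expNeg x = r := by
  rcases eq_or_ne r 0 with rfl | h0
  · exact ⟨∞, by simp [expNeg_top]⟩
  have hpos : (0 : ℝ) < r := by positivity
  have hlog : Real.log r ≤ 0 := Real.log_nonpos hpos.le (by exact_mod_cast hr)
  refine ⟨((-Real.log r).toNNReal : ℝ≥0), ?_⟩
  rw [expNeg_coe, Real.coe_toNNReal _ (by linarith), neg_neg, Real.exp_log hpos,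
    ENNReal.ofReal_coe_nnreal]

/-- `x ↦ e^{-x}` as a map from `[0,∞]` to `[0,1]`. -/
def expNegIcc (x : ℝ≥0∞) : Icc (0 : ℝ) 1 :=
  ⟨(expNeg x).toReal, ENNReal.toReal_nonneg, ENNReal.toReal_le_of_le_ofReal zero_le_one
    (by simpa using expNeg_le_one x)⟩

lemma measurable_expNegIcc : Measurable expNegIcc :=
  (measurable_expNeg.ennreal_toReal).subtype_mk

lemma expNegIcc_injective : Function.Injective expNegIcc := fun x y h => by
  have h' : (expNeg x).toReal = (expNeg y).toReal := by
    have h1 := Subtype.ext_iff.1 h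
    exact h1
  exact expNeg_strictAnti.injective
    ((ENNReal.toReal_eq_toReal_iff' (expNeg_ne_top _) (expNeg_ne_top _)).1 h')

/-- Uniqueness in the Hausdorff moment problem: polynomials are uniformly dense in the continuous
functions by Weierstrass. -/
lemma ext_of_integral_pow_Icc {μ ν : Measure (Icc (0 : ℝ) 1)} [IsFiniteMeasure μ]
    [IsFiniteMeasure ν] (h : ∀ n : ℕ, ∫ x, (x : ℝ) ^ n ∂μ = ∫ x, (x : ℝ) ^ n ∂ν) : μ = ν := by
  have hint : ∀ (κ : Measure (Icc (0 : ℝ) 1)) [IsFiniteMeasure κ] (f : Icc (0 : ℝ) 1 → ℝ),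
      Continuous f → Integrable f κ := fun κ _ f hf => by
    simpa using (hf.continuousOn (s := univ)).integrableOn_compact (μ := κ) isCompact_univ
  have hpoly : ∀ p : Polynomial ℝ, ∫ x, p.eval (x : ℝ) ∂μ = ∫ x, p.eval (x : ℝ) ∂ν := by
    intro p
    simp_rw [Polynomial.eval_eq_sum_range]
    rw [integral_finsetSum _ fun i _ => hint _ _ (by fun_prop),
      integral_finsetSum _ fun i _ => hint _ _ (by fun_prop)]
    refine Finset.sum_congr rfl fun i _ => ?_
    rw [integral_const_mul, integral_const_mul, h]
  refine ext_of_forall_integral_eq_of_IsFiniteMeasure fun f => ?_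
  by_contra hne
  set d := |∫ x, f x ∂μ - ∫ x, f x ∂ν| with hd
  have hdpos : 0 < d := abs_pos.2 (sub_ne_zero.2 hne)
  set M := μ.real univ + ν.real univ + 1 with hM
  have hMpos : 0 < M := by positivity
  -- M exceeds the sum of the two total masses, so with tolerance d / M the two approximation errors
  -- add up to less than d.
  obtain ⟨p, hp⟩ := exists_polynomial_near_continuousMap 0 1 f.toContinuousMap (d / M)
    (by positivity)
  have hpt : ∀ x : Icc (0 : ℝ) 1, ‖p.eval (x : ℝ) - f x‖ ≤ d / M := fun x =>
    ((ContinuousMap.norm_coe_le_norm (p.toContinuousMapOn _ - f.toContinuousMap) x).trans hp.le)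
  have key : ∀ (κ : Measure (Icc (0 : ℝ) 1)) [IsFiniteMeasure κ],
      |∫ x, p.eval (x : ℝ) ∂κ - ∫ x, f x ∂κ| ≤ d / M * κ.real univ := fun κ _ => by
    rw [← integral_sub (hint _ _ (by fun_prop)) (hint _ _ (by fun_prop))]
    exact norm_integral_le_of_norm_le_const (ae_of_all _ hpt)
  have h1 := key μ
  have h2 := key ν
  rw [← hpoly] at h2
  have h3 : d ≤ d / M * μ.real univ + d / M * ν.real univ := by
    rw [hd]
    rw [abs_le] at h1 h2
    rw [← hd, abs_le]
    constructor <;> linarith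
  have h4 : d / M * μ.real univ + d / M * ν.real univ = d * ((M - 1) / M) := by
    rw [hM]; ring
  have h5 : (M - 1) / M < 1 := by rw [div_lt_one hMpos]; linarith
  nlinarith

/-- A finite measure on `[0,∞]` is determined by the values of its Laplace transform at the
natural numbers, and its total mass. -/
lemma ext_of_lintegral_expNeg_pow {μ ν : Measure ℝ≥0∞} [IsFiniteMeasure μ] [IsFiniteMeasure ν]
    (h : ∀ n : ℕ, ∫⁻ x, expNeg x ^ n ∂μ = ∫⁻ x, expNeg x ^ n ∂ν) : μ = ν := by
  have hemb : MeasurableEmbedding expNegIcc :=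
    measurable_expNegIcc.measurableEmbedding expNegIcc_injective
  have hmap : μ.map expNegIcc = ν.map expNegIcc := by
    refine ext_of_integral_pow_Icc fun n => ?_
    have key : ∀ κ : Measure ℝ≥0∞, ∫ x, (x : ℝ) ^ n ∂(κ.map expNegIcc)
        = (∫⁻ x, expNeg x ^ n ∂κ).toReal := fun κ => by
      rw [hemb.integral_map, ← integral_toReal]
      · simp [expNegIcc]
      · exact (measurable_expNeg.pow_const n).aemeasurable
      · exact ae_of_all _ fun x => ENNReal.pow_lt_top (expNeg_ne_top x).lt_top
    rw [key, key, h]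
  rw [← hemb.comap_map μ, hmap, hemb.comap_map]

lemma lintegral_expNeg_pow_le_one {Ω : Type*} [MeasurableSpace Ω] (P : Measure Ω)
    [IsProbabilityMeasure P] (Y : Ω → ℝ≥0∞) (n : ℕ) : ∫⁻ ω, expNeg (Y ω) ^ n ∂P ≤ 1 := by
  calc ∫⁻ ω, expNeg (Y ω) ^ n ∂P ≤ ∫⁻ _, 1 ∂P :=
        lintegral_mono fun ω => pow_le_one₀ (zero_le) (expNeg_le_one _)
    _ = 1 := by simp

/-- Two `[0,∞]`-valued random variables are independent as soon as their joint Laplace transform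
factorizes on pairs of natural numbers. -/
lemma indepFun_iff_lintegral_expNeg_pow {Ω : Type*} [MeasurableSpace Ω] {P : Measure Ω}
    [IsProbabilityMeasure P] {U V : Ω → ℝ≥0∞} (hU : Measurable U) (hV : Measurable V) :
    IndepFun U V P ↔ ∀ a b : ℕ, ∫⁻ ω, expNeg (U ω) ^ a * expNeg (V ω) ^ b ∂P
      = (∫⁻ ω, expNeg (U ω) ^ a ∂P) * ∫⁻ ω, expNeg (V ω) ^ b ∂P := by
  have hm : ∀ n : ℕ, Measurable fun x => expNeg x ^ n := fun n => measurable_expNeg.pow_const n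
  constructor
  · intro h a b
    exact lintegral_mul_eq_lintegral_mul_lintegral_of_indepFun ((hm a).comp hU) ((hm b).comp hV)
      (h.comp (hm a) (hm b))
  · intro h
    -- The exponentials are replaced by events one variable at a time. Under the weight e^{-bV} the
    -- law of U is a multiple of its law under P; restricting to {U ∈ A} afterwards treats V in the
    -- same way.
    have hsection : ∀ b : ℕ, ∀ A, MeasurableSet A → ∫⁻ ω in U ⁻¹' A, expNeg (V ω) ^ b ∂P
        = (∫⁻ ω, expNeg (V ω) ^ b ∂P) * P (U ⁻¹' A) := by
      intro b A hA
      set c := ∫⁻ ω, expNeg (V ω) ^ b ∂P with hc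
      have hc1 : c ≤ 1 := lintegral_expNeg_pow_le_one P V b
      have hfin : c ≠ ∞ := (hc1.trans_lt ENNReal.one_lt_top).ne
      have : IsFiniteMeasure (P.withDensity fun ω => expNeg (V ω) ^ b) :=
        isFiniteMeasure_withDensity hfin
      have : IsFiniteMeasure (c • P.map U) := Measure.smul_finite _ hfin
      have heq : (P.withDensity fun ω => expNeg (V ω) ^ b).map U = c • P.map U := by
        refine ext_of_lintegral_expNeg_pow fun a => ?_
        rw [lintegral_map (hm a) hU, lintegral_withDensity_eq_lintegral_mul P
            (f := fun ω => expNeg (V ω) ^ b) ((hm b).comp hV)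
            (g := fun ω => expNeg (U ω) ^ a) ((hm a).comp hU), lintegral_smul_measure,
          lintegral_map (hm a) hU, smul_eq_mul,
          mul_comm c, ← h]
        exact lintegral_congr fun ω => mul_comm _ _
      have := congrArg (fun κ : Measure ℝ≥0∞ => κ A) heq
      simpa [Measure.map_apply hU hA, withDensity_apply _ (hU hA)] using this
    rw [indepFun_iff_measure_inter_preimage_eq_mul]
    intro A B hA hB
    have heq : (P.restrict (U ⁻¹' A)).map V = P (U ⁻¹' A) • P.map V := by
      have : IsFiniteMeasure (P (U ⁻¹' A) • P.map V) := Measure.smul_finite _ (measure_ne_top _ _)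
      refine ext_of_lintegral_expNeg_pow fun b => ?_
      rw [lintegral_map (hm b) hV, hsection b A hA, lintegral_smul_measure, lintegral_map (hm b) hV,
        smul_eq_mul, mul_comm]
    have := congrArg (fun κ : Measure ℝ≥0∞ => κ B) heq
    simpa [Measure.map_apply hV hB, Measure.restrict_apply (hV hB), inter_comm] using this

/-! ### Arrivals, first epochs and the initial run of marks. -/

section

variable {Ω : Type*}

lemma arrival_zero (T : ℕ → Ω → ℝ≥0∞) (ω : Ω) : arrival T 0 ω = T 0 ω := by simp [arrival]

lemma arrival_mono (T : ℕ → Ω → ℝ≥0∞) (ω : Ω) : Monotone fun n => arrival T n ω :=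
  fun _ _ h => Finset.sum_le_sum_of_subset (Finset.range_mono (by omega))

lemma measurable_arrival [MeasurableSpace Ω] {T : ℕ → Ω → ℝ≥0∞} (hT : ∀ i, Measurable (T i)) (n : ℕ) :
    Measurable (arrival T n) := by
  unfold arrival
  exact Finset.measurable_fun_sum _ fun i _ => hT i

/-- A countable infimum over arrivals replaces the one over all times; this gives measurability and
the value once the first index with mark i is known. -/
lemma firstEpoch_eq_iInf (T : ℕ → Ω → ℝ≥0∞) (X : ℕ → Ω → Fin 2) (i : Fin 2) (ω : Ω) :
    firstEpoch T X i ω = ⨅ n, if X n ω = i then arrival T n ω else ∞ := by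
  apply le_antisymm
  · refine le_iInf fun n => ?_
    split_ifs with h
    · rcases eq_or_ne (arrival T n ω) ∞ with htop | htop
      · rw [htop]; exact le_top
      · rw [← ENNReal.coe_toNNReal htop]
        refine iInf₂_le (arrival T n ω).toNNReal ?_
        refine one_le_encard_iff_nonempty.2 ⟨n, ?_, h⟩
        rw [ENNReal.coe_toNNReal htop]
    · exact le_top
  · refine le_iInf₂ fun t ht => ?_
    obtain ⟨n, hn, hX⟩ := one_le_encard_iff_nonempty.1 ht
    exact (iInf_le _ n).trans (by simpa [hX] using hn)

lemma measurable_firstEpoch [MeasurableSpace Ω] {T : ℕ → Ω → ℝ≥0∞} {X : ℕ → Ω → Fin 2}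
    (hT : ∀ i, Measurable (T i)) (hX : ∀ i, Measurable (X i)) (i : Fin 2) :
    Measurable (firstEpoch T X i) := by
  rw [show firstEpoch T X i = fun ω => ⨅ n, if X n ω = i then arrival T n ω else ∞ from
    funext (firstEpoch_eq_iInf T X i)]
  refine Measurable.iInf fun n => Measurable.ite ?_ (measurable_arrival hT n) measurable_const
  exact hX n (measurableSet_singleton i)

lemma firstEpoch_eq_arrival {T : ℕ → Ω → ℝ≥0∞} {X : ℕ → Ω → Fin 2} {i : Fin 2} {ω : Ω} {n : ℕ}
    (hn : X n ω = i) (hlt : ∀ m < n, X m ω ≠ i) : firstEpoch T X i ω = arrival T n ω := by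
  rw [firstEpoch_eq_iInf]
  apply le_antisymm
  · exact (iInf_le _ n).trans (by simp [hn])
  · refine le_iInf fun m => ?_
    split_ifs with h
    · exact arrival_mono T ω (not_lt.1 fun hm => hlt m hm h)
    · exact le_top

/-- The set of mark sequences whose marks `0, …, n` are equal to `j`, and whose mark `n + 1`
is not. -/
def initialRun (j : Fin 2) (n : ℕ) : Set (ℕ → Fin 2) :=
  {x | (∀ m ≤ n, x m = j) ∧ x (n + 1) = 1 - j}

lemma initialRun_eq (j : Fin 2) (n : ℕ) : initialRun j n =
    ⋂ m ∈ Finset.range (n + 2), (fun x : ℕ → Fin 2 => x m) ⁻¹' {if m = n + 1 then 1 - j else j} := by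
  ext x
  simp only [initialRun, mem_ofPred_eq, mem_iInter, mem_preimage, mem_singleton_iff,
    Finset.mem_range]
  constructor
  · rintro ⟨h1, h2⟩ m hm
    split_ifs with h
    · rw [h, h2]
    · exact h1 m (by omega)
  · intro h
    refine ⟨fun m hm => ?_, ?_⟩
    · simpa [show m ≠ n + 1 by omega] using h m (by omega)
    · simpa using h (n + 1) (by omega)

lemma measurableSet_initialRun (j : Fin 2) (n : ℕ) : MeasurableSet (initialRun j n) := by
  rw [initialRun_eq]
  exact Finset.measurableSet_biInter _ fun m _ => measurable_pi_apply m (measurableSet_singleton _)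

lemma ne_one_sub (j : Fin 2) : j ≠ 1 - j := by
  fin_cases j <;> decide

lemma pairwise_disjoint_initialRun :
    Pairwise (Function.onFun Disjoint fun k : Fin 2 × ℕ => initialRun k.1 k.2) := by
  rintro ⟨i, m⟩ ⟨j, n⟩ hne
  refine disjoint_left.2 fun x hx hy => hne ?_
  simp only [initialRun, mem_ofPred_eq] at hx hy
  have hij : i = j := (hx.1 0 (Nat.zero_le _)).symm.trans (hy.1 0 (Nat.zero_le _))
  subst hij
  rcases lt_trichotomy m n with h | h | h
  · exact absurd ((hy.1 (m + 1) h).symm.trans hx.2) (ne_one_sub i)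
  · rw [h]
  · exact absurd ((hx.1 (n + 1) h).symm.trans hy.2) (ne_one_sub i)

lemma exists_mem_initialRun {x : ℕ → Fin 2} (h : ∀ j, ∃ n, x n ≠ j) :
    ∃ k : Fin 2 × ℕ, x ∈ initialRun k.1 k.2 := by
  classical
  have hex := h (x 0)
  set N := Nat.find hex with hN
  have hspec : x N ≠ x 0 := Nat.find_spec hex
  have hpos : N ≠ 0 := fun h0 => hspec (by rw [h0])
  obtain ⟨n, hn⟩ := Nat.exists_eq_succ_of_ne_zero hpos
  refine ⟨(x 0, n), fun m hm => ?_, ?_⟩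
  · by_contra hne
    exact Nat.find_min hex (m := m) (by omega) hne
  · have h1 : x (n + 1) ≠ x 0 := by rw [← Nat.succ_eq_add_one, ← hn]; exact hspec
    revert h1
    generalize x (n + 1) = u
    generalize x 0 = v
    revert u v
    change ∀ u v : Fin 2, u ≠ v → u = 1 - v
    decide

section Marks

variable [MeasurableSpace Ω] {P : Measure Ω} {X : ℕ → Ω → Fin 2} {w : Fin 2 → ℝ≥0∞}

lemma measure_initialRun (hX : iIndepFun X P) (hw : ∀ j i, P (X i ⁻¹' {j}) = w j)
    (j : Fin 2) (n : ℕ) :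
    P ((fun ω i => X i ω) ⁻¹' initialRun j n) = w j ^ (n + 1) * w (1 - j) := by
  rw [initialRun_eq, preimage_iInter₂]
  have := hX.measure_inter_preimage_eq_mul (Finset.range (n + 2))
    (sets := fun m => {if m = n + 1 then 1 - j else j}) fun _ _ => measurableSet_singleton _
  simp only [hw] at this
  rw [Finset.prod_range_succ] at this
  simp only [if_true] at this
  rw [Finset.prod_congr rfl (g := fun _ => w j), Finset.prod_const, Finset.card_range] at this
  · exact this
  · intro m hm
    rw [if_neg (by rw [Finset.mem_range] at hm; omega)]

lemma ae_exists_mem_initialRun (hX : iIndepFun X P) (hw : ∀ j i, P (X i ⁻¹' {j}) = w j)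
    (hw1 : ∀ j, w j < 1) :
    ∀ᵐ ω ∂P, ∃ k : Fin 2 × ℕ, (fun i => X i ω) ∈ initialRun k.1 k.2 := by
  have h : ∀ᵐ ω ∂P, ∀ j, ∃ n, X n ω ≠ j := by
    rw [ae_all_iff]
    intro j
    rw [ae_iff]
    have hle : ∀ n : ℕ, P {ω | ¬ ∃ n, X n ω ≠ j} ≤ w j ^ n := fun n => by
      have := hX.measure_inter_preimage_eq_mul (Finset.range n)
        (sets := fun _ => {j}) fun _ _ => measurableSet_singleton _
      simp only [hw, Finset.prod_const, Finset.card_range] at this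
      rw [← this]
      refine measure_mono fun ω hω => ?_
      simp only [mem_ofPred_eq, not_exists, not_not] at hω
      simp [hω]
    exact le_antisymm (ge_of_tendsto' (ENNReal.tendsto_pow_atTop_nhds_zero_of_lt_one (hw1 j)) hle)
      zero_le
  filter_upwards [h] with ω hω using exists_mem_initialRun hω

lemma lintegral_initialRun_eq {T : ℕ → Ω → ℝ≥0∞} (hT : ∀ i, Measurable (T i))
    (hXm : ∀ i, Measurable (X i)) (hTX : IndepFun (fun ω i => T i ω) (fun ω i => X i ω) P)
    {F : (ℕ → ℝ≥0∞) → ℝ≥0∞} (hF : Measurable F) {D : Set (ℕ → Fin 2)} (hD : MeasurableSet D) :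
    ∫⁻ ω in (fun ω i => X i ω) ⁻¹' D, F (fun i => T i ω) ∂P
      = P ((fun ω i => X i ω) ⁻¹' D) * ∫⁻ ω, F (fun i => T i ω) ∂P := by
  have hTm : Measurable fun ω i => T i ω := measurable_pi_iff.2 hT
  have hXm' : Measurable fun ω i => X i ω := measurable_pi_iff.2 hXm
  have h1 : Measurable (D.indicator (1 : (ℕ → Fin 2) → ℝ≥0∞)) := measurable_one.indicator hD
  have := lintegral_mul_eq_lintegral_mul_lintegral_of_indepFun (h1.comp hXm') (hF.comp hTm)
    (hTX.symm.comp h1 hF)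
  have e1 : D.indicator (1 : (ℕ → Fin 2) → ℝ≥0∞) ∘ (fun ω i => X i ω)
      = ((fun ω i => X i ω) ⁻¹' D).indicator 1 := rfl
  rw [e1, lintegral_indicator_one (hXm' hD)] at this
  rw [← lintegral_indicator (hXm' hD)]
  refine Eq.trans (lintegral_congr fun ω => ?_) this
  by_cases h : ω ∈ (fun ω i => X i ω) ⁻¹' D <;> simp [h]

/-- Split by the initial run. If mark j runs through index n, the epoch of j is the first arrival
and that of 1 - j is the arrival of index n + 1; both depend on T only, hence are independent of the
run. The first series collects j = 0, the second j = 1. -/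
lemma lintegral_firstEpoch_mul {T : ℕ → Ω → ℝ≥0∞} (hT : ∀ i, Measurable (T i))
    (hXm : ∀ i, Measurable (X i)) (hTX : IndepFun (fun ω i => T i ω) (fun ω i => X i ω) P)
    (hX : iIndepFun X P) (hw : ∀ j i, P (X i ⁻¹' {j}) = w j) (hw1 : ∀ j, w j < 1)
    {f g : ℝ≥0∞ → ℝ≥0∞} (hf : Measurable f) (hg : Measurable g) :
    ∫⁻ ω, f (firstEpoch T X 0 ω) * g (firstEpoch T X 1 ω) ∂P
      = (∑' n, w 0 ^ (n + 1) * w 1 * ∫⁻ ω, f (arrival T 0 ω) * g (arrival T (n + 1) ω) ∂P)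
      + ∑' n, w 1 ^ (n + 1) * w 0 * ∫⁻ ω, f (arrival T (n + 1) ω) * g (arrival T 0 ω) ∂P := by
  have hXm' : Measurable fun ω i => X i ω := measurable_pi_iff.2 hXm
  set D : Fin 2 × ℕ → Set Ω := fun k => (fun ω i => X i ω) ⁻¹' initialRun k.1 k.2 with hDdef
  have hDm : ∀ k, MeasurableSet (D k) := fun k => hXm' (measurableSet_initialRun _ _)
  have hcover : (⋃ k, D k) =ᵐ[P] univ := by
    rw [ae_eq_univ]
    have := ae_exists_mem_initialRun hX hw hw1
    rw [ae_iff] at this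
    convert this using 2
    ext ω; simp [hDdef]
  rw [← setLIntegral_univ, ← setLIntegral_congr hcover, lintegral_iUnion hDm
    (fun i j hij => (pairwise_disjoint_initialRun hij).preimage _), ENNReal.tsum_prod',
    tsum_fintype, Fin.sum_univ_two]
  have harr : ∀ n, Measurable fun t : ℕ → ℝ≥0∞ => ∑ i ∈ Finset.range (n + 1), t i := fun n =>
    Finset.measurable_fun_sum _ fun i _ => measurable_pi_apply i
  have hR : ∀ (j : Fin 2) (n : ℕ) (ω : Ω), ω ∈ D (j, n) →
      firstEpoch T X j ω = arrival T 0 ω ∧ firstEpoch T X (1 - j) ω = arrival T (n + 1) ω := by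
    rintro j n ω ⟨h1, h2⟩
    refine ⟨firstEpoch_eq_arrival (h1 0 (Nat.zero_le _)) fun m hm => absurd hm (Nat.not_lt_zero _),
      firstEpoch_eq_arrival h2 fun m hm => ?_⟩
    have : X m ω = j := h1 m (by omega)
    rw [this]; exact ne_one_sub j
  congr 1
  · refine tsum_congr fun n => ?_
    have h1 := measure_initialRun hX hw 0 n
    rw [sub_zero] at h1
    rw [← h1]
    refine Eq.trans ?_ (lintegral_initialRun_eq hT hXm hTX
      (F := fun t => f (∑ i ∈ Finset.range (0 + 1), t i) * g (∑ i ∈ Finset.range (n + 1 + 1), t i))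
      ((hf.comp (harr _)).mul (hg.comp (harr _))) (measurableSet_initialRun 0 n))
    refine setLIntegral_congr_fun (hDm _) fun ω hω => ?_
    obtain ⟨h2, h3⟩ := hR 0 n ω hω
    rw [sub_zero] at h3
    simp only [h2, h3]
    rfl
  · refine tsum_congr fun n => ?_
    have h1 := measure_initialRun hX hw 1 n
    rw [sub_self] at h1
    rw [← h1]
    refine Eq.trans ?_ (lintegral_initialRun_eq hT hXm hTX
      (F := fun t => f (∑ i ∈ Finset.range (n + 1 + 1), t i) * g (∑ i ∈ Finset.range (0 + 1), t i))
      ((hf.comp (harr _)).mul (hg.comp (harr _))) (measurableSet_initialRun 1 n))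
    refine setLIntegral_congr_fun (hDm _) fun ω hω => ?_
    obtain ⟨h2, h3⟩ := hR 1 n ω hω
    rw [sub_self] at h3
    simp only [h2, h3]
    rfl

end Marks

/-- The first waiting time enters both arrivals and gets exponent a + b; the n + 1 others enter only
the later one and get exponent b. -/
lemma lintegral_expNeg_arrival [MeasurableSpace Ω] {P : Measure Ω} {T : ℕ → Ω → ℝ≥0∞} (hT : ∀ i, Measurable (T i))
    (hTi : iIndepFun T P) (hTid : ∀ j, 1 ≤ j → IdentDistrib (T j) (T 1) P P) (a b n : ℕ) :
    ∫⁻ ω, expNeg (arrival T 0 ω) ^ a * expNeg (arrival T (n + 1) ω) ^ b ∂P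
      = (∫⁻ ω, expNeg (T 0 ω) ^ (a + b) ∂P) * (∫⁻ ω, expNeg (T 1 ω) ^ b ∂P) ^ (n + 1) := by
  have hm : ∀ k : ℕ, Measurable fun x => expNeg x ^ k := fun k => measurable_expNeg.pow_const k
  set c : ℕ → ℕ := fun i => if i = 0 then a + b else b with hc
  have h1 : ∀ ω, expNeg (arrival T 0 ω) ^ a * expNeg (arrival T (n + 1) ω) ^ b
      = ∏ i ∈ Finset.range (n + 2), expNeg (T i ω) ^ c i := fun ω => by
    rw [arrival_zero, arrival, expNeg_sum, ← Finset.prod_pow, Finset.prod_range_succ',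
      Finset.prod_range_succ' _ (n + 1)]
    simp only [hc, Nat.add_eq_zero_iff, one_ne_zero, and_false, if_false, if_true, pow_add]
    ring
  simp_rw [h1]
  rw [lintegral_prod_eq_prod_lintegral_of_indepFun _ (fun i ω => expNeg (T i ω) ^ c i)
    (hTi.comp (fun i x => expNeg x ^ c i) fun i => hm _) fun i => (hm _).comp (hT i),
    Finset.prod_range_succ', mul_comm]
  congr 1
  rw [← Finset.card_range (n + 1), ← Finset.prod_const, Finset.card_range]
  refine Finset.prod_congr rfl fun i _ => ?_
  exact ((hTid (i + 1) (by omega)).comp (hm b)).lintegral_eq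

end

/-! ### Independence of the first epochs as a functional equation. -/

section

variable {Ω : Type*} [MeasurableSpace Ω]

/-- The Laplace transform `E[e^{-nY}]` at the natural number `n`, with the convention that it is
equal to `1` at `n = 0`, even if `Y` takes the value `∞`. -/
def laplace (P : Measure Ω) (Y : Ω → ℝ≥0∞) (n : ℕ) : ℝ := (∫⁻ ω, expNeg (Y ω) ^ n ∂P).toReal

lemma laplace_nonneg (P : Measure Ω) (Y : Ω → ℝ≥0∞) (n : ℕ) : 0 ≤ laplace P Y n :=
  ENNReal.toReal_nonneg

section

variable (P : Measure Ω) [IsProbabilityMeasure P] (Y : Ω → ℝ≥0∞)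

lemma lintegral_expNeg_pow_ne_top (n : ℕ) : ∫⁻ ω, expNeg (Y ω) ^ n ∂P ≠ ∞ :=
  ((lintegral_expNeg_pow_le_one P Y n).trans_lt ENNReal.one_lt_top).ne

lemma laplace_zero : laplace P Y 0 = 1 := by simp [laplace]

lemma laplace_le_one (n : ℕ) : laplace P Y n ≤ 1 :=
  ENNReal.toReal_le_of_le_ofReal zero_le_one (by simpa using lintegral_expNeg_pow_le_one P Y n)

end

lemma map_eq_of_laplace {Ω' : Type*} [MeasurableSpace Ω'] {P : Measure Ω} [IsProbabilityMeasure P]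
    {P' : Measure Ω'} [IsProbabilityMeasure P'] {Y : Ω → ℝ≥0∞} {Y' : Ω' → ℝ≥0∞}
    (hY : Measurable Y) (hY' : Measurable Y')
    (h : ∀ n, 1 ≤ n → laplace P Y n = laplace P' Y' n) : P.map Y = P'.map Y' := by
  have := Measure.isProbabilityMeasure_map (μ := P) hY.aemeasurable
  have := Measure.isProbabilityMeasure_map (μ := P') hY'.aemeasurable
  refine ext_of_lintegral_expNeg_pow fun n => ?_
  rw [lintegral_map (measurable_expNeg.pow_const n) hY,
    lintegral_map (measurable_expNeg.pow_const n) hY']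
  rcases Nat.eq_zero_or_pos n with rfl | hn
  · simp
  · exact (ENNReal.toReal_eq_toReal_iff' (lintegral_expNeg_pow_ne_top P Y n)
      (lintegral_expNeg_pow_ne_top P' Y' n)).1 (h n hn)

lemma toReal_tsum_geometric {w c L0 L : ℝ≥0∞} (hw : w < 1) (hL : L ≤ 1) :
    (∑' n : ℕ, w ^ (n + 1) * c * (L0 * L ^ (n + 1))).toReal
      = L0.toReal * c.toReal * (w.toReal * L.toReal / (1 - w.toReal * L.toReal)) := by
  have h1 : ∀ n : ℕ, w ^ (n + 1) * c * (L0 * L ^ (n + 1)) = L0 * c * (w * L) * (w * L) ^ n :=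
    fun n => by ring
  have hwL : w * L ≤ 1 := mul_le_one' hw.le hL
  simp_rw [h1]
  rw [ENNReal.tsum_mul_left, ENNReal.tsum_geometric, ENNReal.toReal_mul, ENNReal.toReal_mul,
    ENNReal.toReal_mul, ENNReal.toReal_inv, ENNReal.toReal_sub_of_le hwL ENNReal.one_ne_top,
    ENNReal.toReal_mul, ENNReal.toReal_one]
  ring

/-- The joint transform is l0(a+b) times a rational function of l(a) and l(b). It shares with the
product of the marginals the positive factor C = p(1-p) / ((1-(1-p)l(b))(1-p l(a))); cancelling C
removes p. -/
lemma indepFun_firstEpoch_iff {P : Measure Ω} [IsProbabilityMeasure P]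
    {T : ℕ → Ω → ℝ≥0∞} {X : ℕ → Ω → Fin 2} {p : ℝ} (hp : p ∈ Ioo (0 : ℝ) 1)
    (hT : ∀ i, Measurable (T i)) (hTi : iIndepFun T P)
    (hTid : ∀ j, 1 ≤ j → IdentDistrib (T j) (T 1) P P)
    (hXm : ∀ i, Measurable (X i)) (hX : iIndepFun X P)
    (hXp : ∀ i, P.real {ω | X i ω = 1} = p)
    (hTX : IndepFun (fun ω i => T i ω) (fun ω i => X i ω) P) :
    IndepFun (firstEpoch T X 0) (firstEpoch T X 1) P ↔ ∀ a b : ℕ,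
      laplace P (T 0) (a + b) *
        (laplace P (T 1) a + laplace P (T 1) b - laplace P (T 1) a * laplace P (T 1) b)
      = laplace P (T 0) a * laplace P (T 0) b := by
  obtain ⟨hp0, hp1⟩ := hp
  set w : Fin 2 → ℝ≥0∞ := ![ENNReal.ofReal (1 - p), ENNReal.ofReal p] with hwdef
  have hw1' : ∀ i, P (X i ⁻¹' {1}) = ENNReal.ofReal p := fun i => by
    rw [← hXp i, measureReal_def, ENNReal.ofReal_toReal (measure_ne_top _ _)]; rfl
  have hw : ∀ j i, P (X i ⁻¹' {j}) = w j := by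
    intro j i
    fin_cases j
    · have h1 : X i ⁻¹' {0} = (X i ⁻¹' {1})ᶜ := by
        ext ω
        simp only [mem_preimage, mem_singleton_iff, mem_compl_iff]
        generalize X i ω = u
        revert u; decide
      change P (X i ⁻¹' {0}) = ENNReal.ofReal (1 - p)
      rw [h1, prob_compl_eq_one_sub (hXm i (measurableSet_singleton _)), hw1',
        ENNReal.ofReal_sub _ hp0.le, ENNReal.ofReal_one]
    · exact hw1' i
  have hwlt : ∀ j, w j < 1 := by
    intro j
    fin_cases j
    · exact ENNReal.ofReal_lt_one.2 (by linarith)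
    · exact ENNReal.ofReal_lt_one.2 hp1
  have hw0r : (w 0).toReal = 1 - p := ENNReal.toReal_ofReal (by linarith)
  have hw1r : (w 1).toReal = p := ENNReal.toReal_ofReal hp0.le
  have hm : ∀ n : ℕ, Measurable fun x => expNeg x ^ n := fun n => measurable_expNeg.pow_const n
  set l0 := laplace P (T 0) with hl0
  set l := laplace P (T 1) with hl
  have hlz : l 0 = 1 := laplace_zero P _
  have hl0z : l0 0 = 1 := laplace_zero P _
  set J : ℕ → ℕ → ℝ≥0∞ := fun a b =>
    ∫⁻ ω, expNeg (firstEpoch T X 0 ω) ^ a * expNeg (firstEpoch T X 1 ω) ^ b ∂P with hJ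
  have hJfin : ∀ a b, J a b ≠ ∞ := fun a b => by
    refine (lt_of_le_of_lt (b := ∫⁻ _, 1 ∂P) (lintegral_mono fun ω => ?_) (by simp)).ne
    exact mul_le_one' (pow_le_one₀ zero_le (expNeg_le_one _))
      (pow_le_one₀ zero_le (expNeg_le_one _))
  have hJr : ∀ a b, (J a b).toReal = l0 (a + b) *
      (p * ((1 - p) * l b / (1 - (1 - p) * l b)) + (1 - p) * (p * l a / (1 - p * l a))) := by
    intro a b
    have h1 := lintegral_firstEpoch_mul hT hXm hTX hX hw hwlt (hm a) (hm b)
    have h2 := lintegral_expNeg_arrival (P := P) hT hTi hTid a b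
    have h3 : ∀ n, ∫⁻ ω, expNeg (arrival T (n + 1) ω) ^ a * expNeg (arrival T 0 ω) ^ b ∂P
        = (∫⁻ ω, expNeg (T 0 ω) ^ (a + b) ∂P) * (∫⁻ ω, expNeg (T 1 ω) ^ a ∂P) ^ (n + 1) := by
      intro n
      rw [add_comm a b, ← lintegral_expNeg_arrival (P := P) hT hTi hTid b a n]
      exact lintegral_congr fun ω => mul_comm _ _
    simp_rw [h2, h3] at h1
    have h4 := hJfin a b
    simp only [hJ] at h4 ⊢
    rw [h1] at h4 ⊢
    rw [ENNReal.toReal_add (fun h => h4 (by rw [h, top_add])) (fun h => h4 (by rw [h, add_top])),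
      toReal_tsum_geometric (hwlt 0) (lintegral_expNeg_pow_le_one P _ _),
      toReal_tsum_geometric (hwlt 1) (lintegral_expNeg_pow_le_one P _ _), hw0r, hw1r]
    simp only [hl0, hl, laplace]
    ring
  rw [indepFun_iff_lintegral_expNeg_pow (measurable_firstEpoch hT hXm 0)
    (measurable_firstEpoch hT hXm 1)]
  refine forall_congr' fun a => forall_congr' fun b => ?_
  -- A marginal is the joint transform at exponent 0, because 0 ^ 0 = 1 covers an infinite epoch as
  -- well.
  have e1 : ∫⁻ ω, expNeg (firstEpoch T X 0 ω) ^ a ∂P = J a 0 := by simp [hJ]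
  have e2 : ∫⁻ ω, expNeg (firstEpoch T X 1 ω) ^ b ∂P = J 0 b := by simp [hJ]
  rw [e1, e2]
  change J a b = _ ↔ _
  rw [← ENNReal.toReal_eq_toReal_iff' (hJfin a b) (ENNReal.mul_ne_top (hJfin _ _) (hJfin _ _)),
    ENNReal.toReal_mul, hJr, hJr, hJr, hlz, add_zero, zero_add]
  have ha0 : 0 ≤ l a := laplace_nonneg P _ _
  have ha1 : l a ≤ 1 := laplace_le_one P _ _
  have hb0 : 0 ≤ l b := laplace_nonneg P _ _
  have hb1 : l b ≤ 1 := laplace_le_one P _ _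
  have hda : 0 < 1 - p * l a := by nlinarith
  have hdb : 0 < 1 - (1 - p) * l b := by nlinarith
  have hq : 0 < 1 - p := by linarith
  have hqq : 1 - (1 - p) ≠ 0 := by linarith
  have f1 : p * ((1 - p) * l b / (1 - (1 - p) * l b)) + (1 - p) * (p * l a / (1 - p * l a))
      = p * (1 - p) / ((1 - (1 - p) * l b) * (1 - p * l a)) * (l a + l b - l a * l b) := by
    field_simp
    ring
  have f2 : p * ((1 - p) * 1 / (1 - (1 - p) * 1)) + (1 - p) * (p * l a / (1 - p * l a))
      = (1 - p) / (1 - p * l a) := by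
    field_simp
    ring
  have f3 : p * ((1 - p) * l b / (1 - (1 - p) * l b)) + (1 - p) * (p * 1 / (1 - p * 1))
      = p / (1 - (1 - p) * l b) := by
    field_simp
    ring
  rw [f1, f2, f3]
  set C := p * (1 - p) / ((1 - (1 - p) * l b) * (1 - p * l a)) with hC
  have hCpos : 0 < C := by positivity
  have f4 : l0 a * ((1 - p) / (1 - p * l a)) * (l0 b * (p / (1 - (1 - p) * l b)))
      = C * (l0 a * l0 b) := by
    rw [hC]; field_simp
  rw [f4, mul_left_comm, mul_right_inj' hCpos.ne']

end

/-! ### The exponential law on [0,∞]. -/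

/-- The exponential distribution as a measure on `[0,∞]`. -/
def expLaw (θ : ℝ≥0) : Measure ℝ≥0∞ := (expMeasure θ).map ENNReal.ofReal

lemma isProbabilityMeasure_expLaw {θ : ℝ≥0} (hθ : 0 < θ) : IsProbabilityMeasure (expLaw θ) := by
  have := isProbabilityMeasure_expMeasure (r := θ) hθ
  exact Measure.isProbabilityMeasure_map (by fun_prop)

lemma expLaw_Iic {θ : ℝ≥0} (hθ : 0 < θ) (t : ℝ≥0) :
    expLaw θ (Iic t) = ENNReal.ofReal (1 - Real.exp (-(θ * t))) := by
  have := isProbabilityMeasure_expMeasure (r := θ) hθ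
  have h : ENNReal.ofReal ⁻¹' Iic (t : ℝ≥0∞) = Iic (t : ℝ) := by
    ext x
    simp [ENNReal.ofReal_le_iff_le_toReal]
  rw [expLaw, Measure.map_apply (by fun_prop) measurableSet_Iic, h, ← ofReal_cdf,
    cdf_expMeasure_eq (r := θ) hθ, if_pos t.coe_nonneg]

lemma expLaw_Ioi {θ : ℝ≥0} (hθ : 0 < θ) (t : ℝ≥0) :
    expLaw θ (Ioi t) = ENNReal.ofReal (Real.exp (-(θ * t))) := by
  have := isProbabilityMeasure_expLaw hθ
  rw [← compl_Iic, prob_compl_eq_one_sub measurableSet_Iic, expLaw_Iic hθ, ← ENNReal.ofReal_one,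
    ← ENNReal.ofReal_sub _ (by simp; positivity)]
  congr 1
  ring

lemma lintegral_expLaw (θ : ℝ≥0) {f : ℝ≥0∞ → ℝ≥0∞} (hf : Measurable f) :
    ∫⁻ x, f x ∂expLaw θ
      = ∫⁻ x in Ici (0 : ℝ), ENNReal.ofReal (θ * Real.exp (-(θ * x))) * f (ENNReal.ofReal x) := by
  rw [expLaw, lintegral_map hf (by fun_prop), expMeasure, gammaMeasure,
    lintegral_withDensity_eq_lintegral_mul _ (f := gammaPDF 1 θ)
      (measurable_gammaPDFReal 1 θ).ennreal_ofReal
      (g := fun x => f (ENNReal.ofReal x)) (hf.comp (by fun_prop)), ← lintegral_indicator measurableSet_Ici]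
  refine lintegral_congr fun x => ?_
  have h : gammaPDF 1 θ x = exponentialPDF θ x := rfl
  change gammaPDF 1 θ x * f (ENNReal.ofReal x) = _
  rw [h, exponentialPDF_eq]
  by_cases hx : 0 ≤ x
  · rw [if_pos hx, indicator_of_mem (by exact hx)]
  · rw [if_neg hx, indicator_of_notMem (by exact hx)]
    simp

/-- The factor e^{-nx} turns the density of rate θ into θ/(θ+n) times the density of rate θ + n,
whose mass is 1. -/
lemma lintegral_expNeg_pow_expLaw {θ : ℝ≥0} (hθ : 0 < θ) (n : ℕ) :
    ∫⁻ x, expNeg x ^ n ∂expLaw θ = ENNReal.ofReal (θ / (θ + n)) := by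
  have hpos : 0 < θ + n := by positivity
  have := isProbabilityMeasure_expLaw hpos
  have h1 := lintegral_expLaw (θ + n) (f := 1) measurable_one
  simp only [Pi.one_apply, lintegral_one, measure_univ, mul_one] at h1
  rw [lintegral_expLaw θ (measurable_expNeg.pow_const n),
    ← mul_one (ENNReal.ofReal (θ / (θ + n))), h1, ← lintegral_const_mul _ (by fun_prop)]
  refine setLIntegral_congr_fun measurableSet_Ici fun x hx => ?_
  have hx' : ((x.toNNReal : ℝ≥0) : ℝ) = x := Real.coe_toNNReal x hx
  have h2 : expNeg (ENNReal.ofReal x) = ENNReal.ofReal (Real.exp (-x)) := by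
    rw [ENNReal.ofReal, expNeg_coe, hx']
  simp only [h2]
  rw [← ENNReal.ofReal_pow (Real.exp_nonneg _), ← ENNReal.ofReal_mul (by positivity),
    ← ENNReal.ofReal_mul (by positivity), ← Real.exp_nat_mul, mul_assoc, ← Real.exp_add]
  push_cast
  have h3 : ((θ : ℝ) + n) ≠ 0 := by positivity
  congr 1
  rw [← mul_assoc, div_mul_cancel₀ _ h3]
  congr 2
  ring

lemma laplace_of_map_eq_expLaw {Ω : Type*} [MeasurableSpace Ω] {P : Measure Ω} {Y : Ω → ℝ≥0∞}
    (hY : Measurable Y) {θ : ℝ≥0} (hθ : 0 < θ) (h : P.map Y = expLaw θ) (n : ℕ) :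
    laplace P Y n = θ / (θ + n) := by
  rw [laplace, ← lintegral_map (measurable_expNeg.pow_const n) hY, h,
    lintegral_expNeg_pow_expLaw hθ, ENNReal.toReal_ofReal (by positivity)]

lemma map_eq_expLaw_of_laplace {Ω : Type*} [MeasurableSpace Ω] {P : Measure Ω}
    [IsProbabilityMeasure P] {Y : Ω → ℝ≥0∞} (hY : Measurable Y) {θ : ℝ≥0} (hθ : 0 < θ)
    (h : ∀ n : ℕ, 1 ≤ n → laplace P Y n = θ / (θ + n)) : P.map Y = expLaw θ := by
  have := isProbabilityMeasure_expLaw hθ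
  rw [← Measure.map_id (μ := expLaw θ)]
  refine map_eq_of_laplace hY measurable_id fun n hn => ?_
  rw [h n hn, laplace_of_map_eq_expLaw measurable_id hθ Measure.map_id]

/-- The memoryless property of the exponential distribution. -/
lemma expLaw_memoryless {θ : ℝ≥0} (hθ : 0 < θ) (u : ℝ≥0) {B : Set ℝ≥0∞} (hB : MeasurableSet B) :
    expLaw θ {x | u < x ∧ x - u ∈ B} = ENNReal.ofReal (Real.exp (-(θ * u))) * expLaw θ B := by
  have := isProbabilityMeasure_expLaw hθ
  have hms : Measurable fun x : ℝ≥0∞ => x - u := by fun_prop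
  have hfin : IsFiniteMeasure (ENNReal.ofReal (Real.exp (-(θ * u))) • expLaw θ) :=
    Measure.smul_finite _ ENNReal.ofReal_ne_top
  have key : ((expLaw θ).restrict (Ioi u)).map (fun x : ℝ≥0∞ => x - u)
      = ENNReal.ofReal (Real.exp (-(θ * u))) • expLaw θ := by
    refine Measure.ext_of_Iic _ _ fun a => ?_
    rw [Measure.map_apply hms measurableSet_Iic, Measure.restrict_apply (hms measurableSet_Iic),
      Measure.smul_apply, smul_eq_mul]
    induction a with
    | top => simp [expLaw_Ioi hθ]
    | coe a =>
      have h1 : (fun x : ℝ≥0∞ => x - u) ⁻¹' Iic (a : ℝ≥0∞) ∩ Ioi (u : ℝ≥0∞)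
          = Iic ((a + u : ℝ≥0) : ℝ≥0∞) \ Iic (u : ℝ≥0∞) := by
        ext x
        simp [tsub_le_iff_right, and_comm]
      rw [h1, measure_sdiff (Iic_subset_Iic.2 (by simp)) measurableSet_Iic.nullMeasurableSet
        (measure_ne_top _ _), expLaw_Iic hθ, expLaw_Iic hθ, expLaw_Iic hθ,
        ← ENNReal.ofReal_sub _ (by simp; positivity), ← ENNReal.ofReal_mul (Real.exp_nonneg _)]
      congr 1
      push_cast
      rw [mul_sub, ← Real.exp_add]
      ring_nf
  have := congrArg (fun κ : Measure ℝ≥0∞ => κ B) key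
  rw [Measure.map_apply hms hB, Measure.restrict_apply (hms hB), Measure.smul_apply,
    smul_eq_mul] at this
  rw [← this]
  congr 1
  ext x
  simp [and_comm]

/-- Conditioning on the first arrival x ≤ t: k more arrivals in the remaining time t - x make k + 1.
The exponentials combine to e^{-θt}, and (t - x)^k is integrated over [0,t]. -/
lemma lintegral_expLaw_poisson (θ t : ℝ≥0) (k : ℕ) :
    ∫⁻ x, (Iic (t : ℝ≥0∞)).indicator
      (fun x => poissonMeasure (θ * (t - x.toNNReal)) {k}) x ∂expLaw θ
      = poissonMeasure (θ * t) {k + 1} := by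
  have hmeas : Measurable fun x : ℝ≥0∞ => poissonMeasure (θ * (t - x.toNNReal)) {k} := by
    simp_rw [poissonMeasure_singleton]
    fun_prop
  rw [lintegral_expLaw θ (hmeas.indicator measurableSet_Iic)]
  set g : ℝ → ℝ := fun x => Real.exp (-(θ * t)) * θ ^ (k + 1) / (k.factorial : ℝ) * (t - x) ^ k
    with hg
  have h1 : ∫⁻ x in Ici (0 : ℝ), ENNReal.ofReal (θ * Real.exp (-(θ * x))) *
      (Iic (t : ℝ≥0∞)).indicator
        (fun x => poissonMeasure (θ * (t - x.toNNReal)) {k}) (ENNReal.ofReal x)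
      = ∫⁻ x in Icc (0 : ℝ) t, ENNReal.ofReal (g x) := by
    rw [← lintegral_indicator measurableSet_Ici, ← lintegral_indicator measurableSet_Icc]
    refine lintegral_congr fun x => ?_
    by_cases hx0 : 0 ≤ x
    swap
    · rw [indicator_of_notMem (by exact hx0), indicator_of_notMem (fun h => hx0 h.1)]
    rw [indicator_of_mem (by exact hx0)]
    have hmem : ENNReal.ofReal x ∈ Iic (t : ℝ≥0∞) ↔ x ≤ t := by
      simp [ENNReal.ofReal_le_iff_le_toReal]
    by_cases hxt : x ≤ t
    · rw [indicator_of_mem (hmem.2 hxt), indicator_of_mem (mem_Icc.2 ⟨hx0, hxt⟩), poissonMeasure_singleton,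
        ← ENNReal.ofReal_mul (by positivity)]
      congr 1
      have e1 : (((t - (ENNReal.ofReal x).toNNReal : ℝ≥0)) : ℝ) = t - x := by
        have hle : x.toNNReal ≤ t := Real.toNNReal_le_iff_le_coe.2 hxt
        rw [ENNReal.ofReal, ENNReal.toNNReal_coe, NNReal.coe_sub hle, Real.coe_toNNReal x hx0]
      rw [NNReal.coe_mul, e1, hg]
      have e2 : Real.exp (-(θ * t)) = Real.exp (-(θ * x)) * Real.exp (-(θ * (t - x))) := by
        rw [← Real.exp_add]; ring_nf
      simp only [e2, mul_pow]
      ring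
    · rw [indicator_of_notMem (fun h => hxt (hmem.1 h)), indicator_of_notMem (fun h => hxt h.2),
        mul_zero]
  have hcont : Continuous g := by fun_prop
  have hnn : ∀ x ∈ Icc (0 : ℝ) t, 0 ≤ g x := fun x hx => by
    have : 0 ≤ (t : ℝ) - x := by linarith [hx.2]
    simp only [hg]; positivity
  rw [h1, ← ofReal_integral_eq_lintegral_ofReal
    (hcont.continuousOn.integrableOn_compact isCompact_Icc)
    ((ae_restrict_iff' measurableSet_Icc).2 (ae_of_all _ hnn)), integral_Icc_eq_integral_Ioc,
    ← intervalIntegral.integral_of_le t.coe_nonneg, poissonMeasure_singleton]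
  congr 1
  simp only [hg]
  rw [intervalIntegral.integral_const_mul,
    intervalIntegral.integral_comp_sub_left (fun x => x ^ k) (t : ℝ), integral_pow,
    Nat.factorial_succ]
  push_cast
  have : (k.factorial : ℝ) ≠ 0 := by positivity
  field_simp
  simp [mul_pow]

/-! ### Solutions of the functional equation. -/

section

open Filter Topology

/-- Dividing by l(a) l(b) l(a+b) makes 1/l - 1 additive. -/
lemma eq_inv_one_add_of_functional_eq {l : ℕ → ℝ} (h0 : l 0 = 1) (hpos : ∀ n, 0 < l n)
    (h : ∀ a b, l (a + b) * (l a + l b - l a * l b) = l a * l b) (n : ℕ) :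
    (l n)⁻¹ = 1 + n * ((l 1)⁻¹ - 1) := by
  induction n with
  | zero => simp [h0]
  | succ n ih =>
    have h1 := h n 1
    have hn := (hpos n).ne'
    have h1' := (hpos 1).ne'
    have hn1 := (hpos (n + 1)).ne'
    have h2 : (l (n + 1))⁻¹ = (l n)⁻¹ + (l 1)⁻¹ - 1 := by
      field_simp
      linarith
    rw [h2, ih]
    push_cast
    ring

/-- With u = 1/l0 - 1 the equation reads u(a+b) = u(a) + u(b) - κ u(a) u(b), so 1 - κu is
multiplicative, hence a power r^n. The resulting formula is the transform of a geometric law on a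
lattice. -/
lemma exists_eq_of_functional_eq {c : ℝ} (hc0 : 0 < c) (hc1 : c < 1) {l0 l : ℕ → ℝ}
    (hpos : ∀ n, 0 < l0 n) (hle : ∀ n, l0 n ≤ 1) (hanti : l0 2 ≤ l0 1)
    (hll : ∀ n, l0 n = 1 - c * (1 - l n)) (h0 : l0 0 = 1)
    (h : ∀ a b, l0 (a + b) * (l a + l b - l a * l b) = l0 a * l0 b) :
    ∃ r : ℝ, 0 ≤ r ∧ r ≤ 1 ∧ ∀ n, l0 n = (1 - c ^ 2) / (1 - c ^ 2 * r ^ n) := by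
  set κ : ℝ := (1 - c ^ 2) / c ^ 2 with hκ
  have hc2 : 0 < 1 - c ^ 2 := by nlinarith
  have hκpos : 0 < κ := by positivity
  set g : ℕ → ℝ := fun n => 1 - κ * ((l0 n)⁻¹ - 1) with hg
  have hmul : ∀ a b, g (a + b) = g a * g b := by
    intro a b
    have hab := h a b
    have ea : l a = 1 - (1 - l0 a) / c := by rw [hll a]; field_simp; ring
    have eb : l b = 1 - (1 - l0 b) / c := by rw [hll b]; field_simp; ring
    rw [ea, eb] at hab
    have ha := (hpos a).ne'
    have hb := (hpos b).ne'
    have hab' := (hpos (a + b)).ne'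
    have h1 : (l0 (a + b))⁻¹
        = (1 - (1 - l0 a) * (1 - l0 b) / c ^ 2) * ((l0 a)⁻¹ * (l0 b)⁻¹) := by
      field_simp
      field_simp at hab
      linear_combination -hab
    simp only [hg, h1, hκ]
    field_simp
    ring
  have hle1 : ∀ n, g n ≤ 1 := fun n => by
    have : 1 ≤ (l0 n)⁻¹ := (one_le_inv₀ (hpos n)).2 (hle n)
    simp only [hg]
    nlinarith
  have hg0 : g 0 = 1 := by simp [hg, h0]
  have hpow : ∀ n, g n = g 1 ^ n := fun n => by
    induction n with
    | zero => simp [hg0]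
    | succ n ih => rw [hmul, ih, pow_succ]
  -- Monotonicity of l0 gives g(1)² = g(2) ≤ g(1), which rules out a negative ratio.
  have hg1 : 0 ≤ g 1 := by
    have h1 : g 2 ≤ g 1 := by
      have : (l0 1)⁻¹ ≤ (l0 2)⁻¹ := inv_anti₀ (hpos 2) hanti
      simp only [hg]
      nlinarith
    rw [hpow 2] at h1
    nlinarith [sq_nonneg (g 1)]
  refine ⟨g 1, hg1, hle1 1, fun n => ?_⟩
  rw [← hpow]
  have hden : 1 - c ^ 2 * g n = (1 - c ^ 2) * (l0 n)⁻¹ := by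
    simp only [hg, hκ]
    field_simp
    ring
  rw [hden]
  have := (hpos n).ne'
  field_simp

variable {Ω : Type*} [MeasurableSpace Ω] {P : Measure Ω} [IsProbabilityMeasure P]

lemma measurable_expNeg_pow_comp {Y : Ω → ℝ≥0∞} (hY : Measurable Y) (n : ℕ) :
    Measurable fun ω => expNeg (Y ω) ^ n :=
  (measurable_expNeg.comp hY).pow_const n

lemma laplace_antitone (P : Measure Ω) [IsProbabilityMeasure P] (Y : Ω → ℝ≥0∞) :
    Antitone (laplace P Y) := fun _ _ hmn =>
  ENNReal.toReal_mono (lintegral_expNeg_pow_ne_top P Y _)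
    (lintegral_mono fun _ => pow_le_pow_of_le_one zero_le (expNeg_le_one _) hmn)

lemma laplace_pos {Y : Ω → ℝ≥0∞} (hY : Measurable Y) (h : P {ω | Y ω = ∞} = 0) (n : ℕ) :
    0 < laplace P Y n := by
  refine ENNReal.toReal_pos (fun h0 => ?_) (lintegral_expNeg_pow_ne_top P Y n)
  rw [lintegral_eq_zero_iff (measurable_expNeg_pow_comp hY n)] at h0
  have h1 : ∀ᵐ ω ∂P, False := by
    have h2 : ∀ᵐ ω ∂P, ¬ Y ω = ∞ := by rw [ae_iff]; simpa using h
    filter_upwards [h0, h2] with ω h3 h4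
    refine h4 (expNeg_strictAnti.injective ?_)
    rw [expNeg_top]
    exact eq_zero_of_pow_eq_zero h3
  simp only [Filter.eventually_false_iff_eq_bot, ae_eq_bot] at h1
  exact IsProbabilityMeasure.ne_zero P h1

/-- The functions e^{-nY} converge boundedly to the indicator of {Y = 0}. -/
lemma tendsto_laplace {Y : Ω → ℝ≥0∞} (hY : Measurable Y) :
    Tendsto (laplace P Y) atTop (𝓝 (P.real {ω | Y ω = 0})) := by
  have hms : MeasurableSet {ω | Y ω = 0} := hY (measurableSet_singleton 0)
  rw [measureReal_def, ← lintegral_indicator_one hms]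
  refine (ENNReal.tendsto_toReal (by rw [lintegral_indicator_one hms]; exact measure_ne_top _ _)).comp
    (tendsto_lintegral_of_dominated_convergence (fun _ => 1)
      (fun n => (measurable_expNeg.pow_const n).comp hY)
      (fun n => ae_of_all _ fun ω => pow_le_one₀ zero_le (expNeg_le_one _)) (by simp)
      (ae_of_all _ fun ω => ?_))
  by_cases h : Y ω = 0
  · simp [h, expNeg_zero]
  · rw [indicator_of_notMem (by exact h)]
    refine ENNReal.tendsto_pow_atTop_nhds_zero_of_lt_one ?_
    rw [← expNeg_zero]
    exact expNeg_strictAnti (pos_iff_ne_zero.2 h)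

/-- On {Y < -log z} one has e^{-Y} ≥ z. Mass near 0 thus prevents the transform from decaying as
fast as any given geometric sequence. -/
lemma exists_pow_mul_le_laplace {Y : Ω → ℝ≥0∞} (hY : Measurable Y)
    (h : ∀ ε : ℝ≥0, 0 < ε → 0 < P {ω | Y ω < (ε : ℝ≥0∞)}) {z : ℝ} (hz0 : 0 < z) (hz1 : z < 1) :
    ∃ π : ℝ, 0 < π ∧ ∀ n, z ^ n * π ≤ laplace P Y n := by
  have hlog : 0 < -Real.log z := neg_pos.2 (Real.log_neg hz0 hz1)
  set ε : ℝ≥0 := (-Real.log z).toNNReal with hε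
  have hεz : expNeg ε = ENNReal.ofReal z := by
    rw [expNeg_coe, hε, Real.coe_toNNReal _ hlog.le, neg_neg, Real.exp_log hz0]
  refine ⟨P.real {ω | Y ω < (ε : ℝ≥0∞)},
    ENNReal.toReal_pos (h ε (Real.toNNReal_pos.2 hlog)).ne' (measure_ne_top _ _), fun n => ?_⟩
  have h1 : ENNReal.ofReal z ^ n * P {ω | Y ω < (ε : ℝ≥0∞)} ≤ ∫⁻ ω, expNeg (Y ω) ^ n ∂P := by
    refine le_trans ?_ (mul_meas_ge_le_lintegral (measurable_expNeg_pow_comp hY n)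
      (ENNReal.ofReal z ^ n))
    gcongr
    rename_i ω
    intro hω
    rw [← hεz]
    exact pow_le_pow_left₀ zero_le (expNeg_strictAnti.antitone (le_of_lt hω)) n
  have h2 := ENNReal.toReal_mono (lintegral_expNeg_pow_ne_top P Y n) h1
  rwa [ENNReal.toReal_mul, ENNReal.toReal_pow, ENNReal.toReal_ofReal hz0.le] at h2

/-- Where e^{-Y} ≥ x, the extra factor e^{-aY} costs at most x^a; elsewhere e^{-bY} ≤ x^b is an
error term. -/
lemma pow_mul_laplace_le (Y : Ω → ℝ≥0∞) {x : ℝ} (hx0 : 0 ≤ x) (hx1 : x ≤ 1) (a b : ℕ)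
    (hY : Measurable Y) : x ^ a * laplace P Y b ≤ laplace P Y (a + b) + x ^ b := by
  have hX1 : ENNReal.ofReal x ≤ 1 := ENNReal.ofReal_le_one.2 hx1
  have h1 : ENNReal.ofReal x ^ a * ∫⁻ ω, expNeg (Y ω) ^ b ∂P
      ≤ ∫⁻ ω, expNeg (Y ω) ^ (a + b) ∂P + ENNReal.ofReal x ^ b := by
    rw [← lintegral_const_mul _ (measurable_expNeg_pow_comp hY b)]
    calc ∫⁻ ω, ENNReal.ofReal x ^ a * expNeg (Y ω) ^ b ∂P
        ≤ ∫⁻ ω, (expNeg (Y ω) ^ (a + b) + ENNReal.ofReal x ^ b) ∂P := by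
          refine lintegral_mono fun ω => ?_
          rcases le_total (ENNReal.ofReal x) (expNeg (Y ω)) with h | h
          · refine le_add_right ?_
            rw [pow_add]
            gcongr
          · refine le_add_left ?_
            calc ENNReal.ofReal x ^ a * expNeg (Y ω) ^ b ≤ 1 * ENNReal.ofReal x ^ b := by
                  gcongr
                  exact pow_le_one₀ zero_le hX1
              _ = _ := one_mul _
      _ = _ := by
          rw [lintegral_add_right _ measurable_const]
          simp
  have hf := lintegral_expNeg_pow_ne_top P Y (a + b)
  have hX : ENNReal.ofReal x ^ b ≠ ∞ := ENNReal.pow_ne_top ENNReal.ofReal_ne_top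
  have h2 := ENNReal.toReal_mono (ENNReal.add_ne_top.2 ⟨hf, hX⟩) h1
  rwa [ENNReal.toReal_mul, ENNReal.toReal_add hf hX, ENNReal.toReal_pow, ENNReal.toReal_pow,
    ENNReal.toReal_ofReal hx0] at h2

/-- If `T₀` charges every neighbourhood of `0`, the functional equation forces the law of `T₀` to
be a mixture of the law of `T₁` and of the point mass at `0`. -/
lemma laplace_eq_of_functional_eq {U V : Ω → ℝ≥0∞} (hU : Measurable U) (hV : Measurable V)
    (hess : ∀ ε : ℝ≥0, 0 < ε → 0 < P {ω | U ω < (ε : ℝ≥0∞)})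
    (h : ∀ a b : ℕ, laplace P U (a + b) *
      (laplace P V a + laplace P V b - laplace P V a * laplace P V b)
        = laplace P U a * laplace P U b) (a : ℕ) :
    laplace P U a = 1 - (1 - P.real {ω | V ω = 0}) * (1 - laplace P V a) := by
  set l0 := laplace P U with hl0
  set l := laplace P V with hl
  set m := P.real {ω | V ω = 0} with hm
  have hlim : Tendsto (fun b => 1 - (1 - l a) * (1 - l b)) atTop
      (𝓝 (1 - (1 - l a) * (1 - m))) :=
    ((tendsto_laplace hV).const_sub 1).const_mul (1 - l a) |>.const_sub 1
  have hpos : ∀ b, 0 < l0 b := fun b => by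
    obtain ⟨π, hπ, h1⟩ := exists_pow_mul_le_laplace hU hess (z := 1 / 2) (by norm_num) (by norm_num)
    exact lt_of_lt_of_le (by positivity) (h1 b)
  have hK : ∀ b, 0 ≤ 1 - (1 - l a) * (1 - l b) := fun b => by
    have h1 : 0 ≤ l a := laplace_nonneg _ _ _
    have h2 : 0 ≤ l b := laplace_nonneg _ _ _
    have h3 : l a ≤ 1 := laplace_le_one _ _ _
    have h4 : l b ≤ 1 := laplace_le_one _ _ _
    nlinarith
  have heq : ∀ b, l0 (a + b) * (1 - (1 - l a) * (1 - l b)) = l0 a * l0 b := fun b => by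
    rw [← h a b]; ring
  have hupper : l0 a ≤ 1 - (1 - l a) * (1 - m) := by
    refine ge_of_tendsto' hlim fun b => ?_
    have h1 : l0 (a + b) ≤ l0 b := laplace_antitone P U (by omega)
    have h2 := heq b
    have h3 := mul_le_mul_of_nonneg_right h1 (hK b)
    rw [h2, mul_comm (l0 b)] at h3
    exact le_of_mul_le_mul_right h3 (hpos b)
  -- The cut at x = z² leaves the error z^{2b}, negligible against `l0 b` ≥ π z^b. After division by
  -- `l0 b` only z^b / π remains, which vanishes as b → ∞; then z → 1 closes the gap to the upper
  -- bound.
  have hlower : ∀ z : ℝ, 0 < z → z < 1 → (z ^ 2) ^ a * (1 - (1 - l a) * (1 - m)) ≤ l0 a := by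
    intro z hz0 hz1
    obtain ⟨π, hπ, hπle⟩ := exists_pow_mul_le_laplace hU hess hz0 hz1
    have hlim2 : Tendsto (fun b : ℕ => l0 a + z ^ b / π) atTop (𝓝 (l0 a + 0 / π)) :=
      ((tendsto_pow_atTop_nhds_zero_of_lt_one hz0.le hz1).div_const π).const_add _
    rw [zero_div, add_zero] at hlim2
    refine le_of_tendsto_of_tendsto' (hlim.const_mul _) hlim2 fun b => ?_
    have h1 : (z ^ 2) ^ a * l0 b ≤ l0 (a + b) + (z ^ 2) ^ b :=
      pow_mul_laplace_le U (by positivity) (by nlinarith) a b hU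
    have hK1 : 1 - (1 - l a) * (1 - l b) ≤ 1 := by
      have h3 : l a ≤ 1 := laplace_le_one _ _ _
      have h4 : l b ≤ 1 := laplace_le_one _ _ _
      nlinarith
    have h2 : (z ^ 2) ^ a * l0 b * (1 - (1 - l a) * (1 - l b)) ≤ l0 a * l0 b + (z ^ 2) ^ b := by
      have h3 := mul_le_mul_of_nonneg_right h1 (hK b)
      rw [add_mul, heq b] at h3
      have h4 : (z ^ 2) ^ b * (1 - (1 - l a) * (1 - l b)) ≤ (z ^ 2) ^ b * 1 := by gcongr
      linarith
    have h5 : (z ^ 2) ^ b ≤ z ^ b / π * l0 b := by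
      have h6 : (z ^ 2) ^ b = z ^ b / π * (z ^ b * π) := by field_simp; ring
      rw [h6]
      gcongr
      exact hπle b
    have h7 : ((z ^ 2) ^ a * (1 - (1 - l a) * (1 - l b))) * l0 b ≤ (l0 a + z ^ b / π) * l0 b := by
      nlinarith
    exact le_of_mul_le_mul_right h7 (hpos b)
  have hlower' : 1 - (1 - l a) * (1 - m) ≤ l0 a := by
    have hcont : Tendsto (fun z : ℝ => (z ^ 2) ^ a * (1 - (1 - l a) * (1 - m))) (𝓝[<] 1)
        (𝓝 ((1 ^ 2) ^ a * (1 - (1 - l a) * (1 - m)))) :=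
      ((by fun_prop : Continuous fun z : ℝ => (z ^ 2) ^ a * (1 - (1 - l a) * (1 - m))).tendsto
        1).mono_left nhdsWithin_le_nhds
    rw [one_pow, one_pow, one_mul] at hcont
    refine le_of_tendsto hcont ?_
    filter_upwards [Ioo_mem_nhdsLT (zero_lt_one (α := ℝ))] with z hz using hlower z hz.1 hz.2
  rw [mul_comm (1 - m)]
  exact le_antisymm hupper hlower'

end

/-! ### Lattice solutions and exponential solutions. -/

section

open Filter Topology

/-- The geometric distribution with parameter `1 - ρ` on the lattice `{j λ : j ∈ ℕ}`. -/
def latticeGeometric (ρ : ℝ) (x : ℝ≥0∞) : Measure ℝ≥0∞ :=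
  Measure.sum fun j : ℕ => ENNReal.ofReal ((1 - ρ) * ρ ^ j) • Measure.dirac (j * x)

lemma expNeg_nat_mul (j : ℕ) (x : ℝ≥0∞) : expNeg (j * x) = expNeg x ^ j := by
  have := expNeg_sum (Finset.range j) fun _ => x
  simpa using this

lemma lintegral_latticeGeometric {ρ : ℝ} (hρ0 : 0 ≤ ρ) (hρ1 : ρ < 1) {x : ℝ≥0∞} {r : ℝ}
    (hr0 : 0 ≤ r) (hr1 : r ≤ 1) (hx : expNeg x = ENNReal.ofReal r) (n : ℕ) :
    ∫⁻ y, expNeg y ^ n ∂latticeGeometric ρ x = ENNReal.ofReal ((1 - ρ) / (1 - ρ * r ^ n)) := by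
  have hrn0 : 0 ≤ r ^ n := by positivity
  have hrn1 : r ^ n ≤ 1 := pow_le_one₀ hr0 hr1
  have hq0 : 0 ≤ ρ * r ^ n := by positivity
  have hq1 : ρ * r ^ n < 1 := by nlinarith
  rw [latticeGeometric, lintegral_sum_measure]
  have h1 : ∀ j : ℕ, ∫⁻ y, expNeg y ^ n
      ∂(ENNReal.ofReal ((1 - ρ) * ρ ^ j) • Measure.dirac ((j : ℝ≥0∞) * x))
      = ENNReal.ofReal ((1 - ρ) * (ρ * r ^ n) ^ j) := fun j => by
    have h2 : 0 ≤ (1 - ρ) * ρ ^ j := mul_nonneg (by linarith) (by positivity)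
    rw [lintegral_smul_measure, lintegral_dirac' _ (measurable_expNeg.pow_const n), expNeg_nat_mul,
      hx, smul_eq_mul, ← ENNReal.ofReal_pow hr0, ← ENNReal.ofReal_pow (by positivity),
      ← ENNReal.ofReal_mul h2]
    congr 1
    ring
  simp_rw [h1]
  rw [← ENNReal.ofReal_tsum_of_nonneg (fun j => mul_nonneg (by linarith) (by positivity))
    ((summable_geometric_of_lt_one hq0 hq1).mul_left _), tsum_mul_left,
    tsum_geometric_of_lt_one hq0 hq1, div_eq_mul_inv]

lemma latticeGeometric_compl_range (ρ : ℝ) (x : ℝ≥0∞) :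
    latticeGeometric ρ x (range fun j : ℕ => (j : ℝ≥0∞) * x)ᶜ = 0 := by
  have hms : MeasurableSet (range fun j : ℕ => (j : ℝ≥0∞) * x)ᶜ :=
    (countable_range _).measurableSet.compl
  rw [latticeGeometric, Measure.sum_apply _ hms, ENNReal.tsum_eq_zero]
  intro j
  rw [Measure.smul_apply, Measure.dirac_apply' _ hms, indicator_of_notMem (by simp), smul_zero]

variable {Ω : Type*} [MeasurableSpace Ω] {P : Measure Ω} [IsProbabilityMeasure P]

/-- The span α = x works if 0 < x < ∞. For x = 0 or x = ∞ the only multiples are 0 and ∞, and α = 1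
does. -/
lemma not_nonArithmetic_of_mem_range {Y : Ω → ℝ≥0∞} {x : ℝ≥0∞}
    (h : ∀ᵐ ω ∂P, Y ω ∈ range fun j : ℕ => (j : ℝ≥0∞) * x) : ¬ NonArithmetic Y P := by
  refine not_not.2 ?_
  have hone : ∀ α : ℝ≥0, (∀ j : ℕ, ∃ n : ℕ∞, (j : ℝ≥0∞) * x = (α : ℝ≥0∞) * (n : ℝ≥0∞)) →
      P {ω | ∃ n : ℕ∞, Y ω = (α : ℝ≥0∞) * (n : ℝ≥0∞)} = 1 := by
    intro α hα
    rw [← measure_univ (μ := P)]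
    refine measure_congr (ae_eq_univ.2 (ae_iff.1 ?_))
    filter_upwards [h] with ω hω
    obtain ⟨j, hj⟩ := hω
    obtain ⟨n, hn⟩ := hα j
    exact ⟨n, hj.symm.trans hn⟩
  rcases eq_or_ne x 0 with rfl | h0
  · exact ⟨1, one_pos, hone 1 fun j => ⟨0, by simp⟩⟩
  rcases eq_or_ne x ∞ with rfl | htop
  · refine ⟨1, one_pos, hone 1 fun j => ?_⟩
    rcases eq_or_ne j 0 with rfl | hj
    · exact ⟨0, by simp⟩
    · exact ⟨⊤, by simp [hj]⟩
  · refine ⟨x.toNNReal, ENNReal.toNNReal_pos h0 htop, hone _ fun j => ⟨j, ?_⟩⟩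
    rw [ENNReal.coe_toNNReal htop, mul_comm]
    simp

/-- If the delay has an atom at zero, then solutions of the functional equation are arithmetic. -/
lemma not_nonArithmetic_of_functional_eq {U V : Ω → ℝ≥0∞} (hU : Measurable U) (hV : Measurable V)
    {c : ℝ} (hc0 : 0 < c) (hc1 : c < 1) (hpos : ∀ n, 0 < laplace P U n)
    (hUV : ∀ n, laplace P U n = 1 - c * (1 - laplace P V n))
    (h : ∀ a b : ℕ, laplace P U (a + b) *
      (laplace P V a + laplace P V b - laplace P V a * laplace P V b)
        = laplace P U a * laplace P U b) : ¬ NonArithmetic V P := by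
  obtain ⟨r, hr0, hr1, hr⟩ := exists_eq_of_functional_eq hc0 hc1 hpos (laplace_le_one P U)
    (laplace_antitone P U (by norm_num)) hUV (laplace_zero P U) h
  obtain ⟨x, hx⟩ := exists_expNeg_eq (r := r.toNNReal) (Real.toNNReal_le_one.2 hr1)
  have hc2 : c ^ 2 < 1 := by nlinarith
  have hG := lintegral_latticeGeometric (sq_nonneg c) hc2 hr0 hr1 hx
  have hfin : IsFiniteMeasure (latticeGeometric (c ^ 2) x) := by
    constructor
    have := hG 0
    simp only [pow_zero, lintegral_one] at this
    rw [this]; exact ENNReal.ofReal_lt_top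
  have := Measure.isProbabilityMeasure_map (μ := P) hU.aemeasurable
  have := Measure.isProbabilityMeasure_map (μ := P) hV.aemeasurable
  have hlap : ∀ {Y : Ω → ℝ≥0∞}, Measurable Y → ∀ n,
      ∫⁻ y, expNeg y ^ n ∂P.map Y = ENNReal.ofReal (laplace P Y n) := fun {Y} hY n => by
    rw [lintegral_map (measurable_expNeg.pow_const n) hY, laplace,
      ENNReal.ofReal_toReal (lintegral_expNeg_pow_ne_top P Y n)]
  have hUG : P.map U = latticeGeometric (c ^ 2) x :=
    ext_of_lintegral_expNeg_pow fun n => by rw [hG, hlap hU, hr]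
  have : IsFiniteMeasure (ENNReal.ofReal (1 - c) • Measure.dirac 0
      + ENNReal.ofReal c • P.map V) := by
    have h1 := Measure.smul_finite (Measure.dirac (0 : ℝ≥0∞)) (ENNReal.ofReal_ne_top (r := 1 - c))
    have h2 := Measure.smul_finite (P.map V) (ENNReal.ofReal_ne_top (r := c))
    infer_instance
  -- The relation between the transforms says that the law of U mixes a point mass at 0 with the law
  -- of V. As c > 0, the complement of the lattice, null for U, is null for V.
  have hUmix : P.map U = ENNReal.ofReal (1 - c) • Measure.dirac 0 + ENNReal.ofReal c • P.map V := by
    refine ext_of_lintegral_expNeg_pow fun n => ?_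
    have hl := laplace_nonneg P V n
    rw [lintegral_add_measure, lintegral_smul_measure, lintegral_smul_measure, hlap hU, hlap hV,
      lintegral_dirac' _ (measurable_expNeg.pow_const n), expNeg_zero, one_pow, smul_eq_mul,
      smul_eq_mul, mul_one, ← ENNReal.ofReal_mul hc0.le, ← ENNReal.ofReal_add (by linarith)
      (by positivity), hUV]
    congr 1
    ring
  have hzero := latticeGeometric_compl_range (c ^ 2) x
  rw [← hUG, hUmix, Measure.add_apply, Measure.smul_apply, Measure.smul_apply, add_eq_zero,
    smul_eq_mul, smul_eq_mul, mul_eq_zero, mul_eq_zero, ENNReal.ofReal_eq_zero,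
    ENNReal.ofReal_eq_zero] at hzero
  have hV0 := hzero.2.resolve_left (not_le.2 hc0)
  rw [Measure.map_apply hV (countable_range _).measurableSet.compl] at hV0
  exact not_nonArithmetic_of_mem_range (ae_iff.2 hV0)

/-- Here 1/l(n) = 1 + nη, so the rate is θ = 1/η. The case η = 0 would give l = 1, that is V = 0
almost surely. -/
lemma exists_map_eq_expLaw_of_functional_eq {U V : Ω → ℝ≥0∞} (hU : Measurable U)
    (hV : Measurable V) (hpos : ∀ n, 0 < laplace P U n)
    (hUV : ∀ n, laplace P U n = laplace P V n)
    (hV0 : P.real {ω | V ω = 0} ≠ 1)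
    (h : ∀ a b : ℕ, laplace P U (a + b) *
      (laplace P V a + laplace P V b - laplace P V a * laplace P V b)
        = laplace P U a * laplace P U b) :
    ∃ θ : ℝ≥0, 0 < θ ∧ P.map U = expLaw θ ∧ P.map V = expLaw θ := by
  simp_rw [← hUV] at h
  have hinv := eq_inv_one_add_of_functional_eq (laplace_zero P U) hpos h
  set η := (laplace P U 1)⁻¹ - 1 with hη
  have hη0 : 0 ≤ η := sub_nonneg.2 ((one_le_inv₀ (hpos 1)).2 (laplace_le_one P U 1))
  have hηpos : 0 < η := by
    refine lt_of_le_of_ne hη0 fun h0 => hV0 ?_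
    have h1 : ∀ n, laplace P V n = 1 := fun n => by
      have := hinv n
      rw [← h0, mul_zero, add_zero, inv_eq_one] at this
      rw [← hUV, this]
    have h2 := tendsto_laplace (P := P) hV
    rw [show laplace P V = fun _ => 1 from funext h1] at h2
    exact tendsto_nhds_unique h2 tendsto_const_nhds |>.trans rfl
  have hθ : 0 < (η⁻¹).toNNReal := Real.toNNReal_pos.2 (inv_pos.2 hηpos)
  have hl : ∀ n : ℕ, laplace P U n = ((η⁻¹).toNNReal : ℝ) / ((η⁻¹).toNNReal + n) := fun n => by
    rw [Real.coe_toNNReal _ (inv_pos.2 hηpos).le, ← inv_inv (laplace P U n), hinv n]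
    field_simp
  exact ⟨_, hθ, map_eq_expLaw_of_laplace hU hθ fun n _ => hl n,
    map_eq_expLaw_of_laplace hV hθ fun n _ => by rw [← hUV, hl n]⟩

end

/-! ### Counting arrivals, restarting at a fixed time, and the Markov property. -/

section

/-- The number of arrivals in `[0,t]` as a function of the sequence of waiting times. -/
def count (t : ℝ≥0) (w : ℕ → ℝ≥0∞) : ℕ∞ :=
  {n : ℕ | ∑ i ∈ Finset.range (n + 1), w i ≤ (t : ℝ≥0∞)}.encard

/-- Partial sums are nondecreasing, so the counted indices form an initial segment and index k alone
decides. -/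
lemma succ_le_count_iff (t : ℝ≥0) (w : ℕ → ℝ≥0∞) (k : ℕ) :
    ((k + 1 : ℕ) : ℕ∞) ≤ count t w ↔ ∑ i ∈ Finset.range (k + 1), w i ≤ t := by
  have hmono : ∀ m n : ℕ, m ≤ n →
      ∑ i ∈ Finset.range (m + 1), w i ≤ ∑ i ∈ Finset.range (n + 1), w i := fun m n h =>
    Finset.sum_le_sum_of_subset (Finset.range_mono (by omega))
  constructor
  · intro h
    by_contra hk
    have hsub : {n : ℕ | ∑ i ∈ Finset.range (n + 1), w i ≤ (t : ℝ≥0∞)}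
        ⊆ (Finset.range k : Set ℕ) := fun n hn => by
      rw [Finset.coe_range, mem_Iio]
      by_contra hkn
      exact hk ((hmono k n (not_lt.1 hkn)).trans hn)
    have h1 := h.trans (encard_le_encard hsub)
    rw [encard_coe_eq_coe_finsetCard, Finset.card_range] at h1
    exact absurd (Nat.cast_le.1 h1) (by omega)
  · intro h
    have hsub : (Finset.range (k + 1) : Set ℕ)
        ⊆ {n : ℕ | ∑ i ∈ Finset.range (n + 1), w i ≤ (t : ℝ≥0∞)} := fun n hn => by
      rw [Finset.coe_range, mem_Iio] at hn
      exact (hmono n k (by omega)).trans h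
    have h1 := encard_le_encard hsub
    rwa [encard_coe_eq_coe_finsetCard, Finset.card_range] at h1

lemma count_mono (w : ℕ → ℝ≥0∞) : Monotone fun t => count t w := fun s t h =>
  encard_le_encard fun _ hn => by
    rw [mem_ofPred_eq] at hn ⊢
    exact hn.trans (ENNReal.coe_le_coe.2 h)

lemma measurable_count (t : ℝ≥0) : Measurable (count t) := by
  have hle : ∀ k : ℕ, MeasurableSet {w : ℕ → ℝ≥0∞ | (k : ℕ∞) ≤ count t w} := by
    intro k
    rcases k with _ | k
    · simp
    · simp_rw [succ_le_count_iff]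
      exact measurableSet_le (Finset.measurable_fun_sum _ fun i _ => measurable_pi_apply i)
        measurable_const
  refine measurable_to_countable' fun m => ?_
  induction m with
  | top =>
    have : count t ⁻¹' {⊤} = ⋂ k : ℕ, {w | (k : ℕ∞) ≤ count t w} := by
      ext w
      simp [ENat.eq_top_iff_forall_ge]
    rw [this]
    exact MeasurableSet.iInter hle
  | coe k =>
    have : count t ⁻¹' {(k : ℕ∞)} = {w | (k : ℕ∞) ≤ count t w} \
        {w | ((k + 1 : ℕ) : ℕ∞) ≤ count t w} := by
      ext w
      simp only [mem_preimage, mem_singleton_iff, mem_sdiff, mem_ofPred_eq]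
      constructor
      · intro h
        rw [h]
        exact ⟨le_rfl, fun h1 => absurd (Nat.cast_le.1 h1) (by omega)⟩
      · rintro ⟨h1, h2⟩
        refine le_antisymm ?_ h1
        rw [not_le] at h2
        rw [Nat.cast_add, Nat.cast_one] at h2
        exact Order.le_of_lt_add_one h2
    rw [this]
    exact (hle k).diff (hle (k + 1))

/-- Prepend a waiting time. -/
def cons (x : ℝ≥0∞) (v : ℕ → ℝ≥0∞) : ℕ → ℝ≥0∞
  | 0 => x
  | i + 1 => v i

lemma measurable_cons : Measurable fun q : ℝ≥0∞ × (ℕ → ℝ≥0∞) => cons q.1 q.2 := by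
  refine measurable_pi_iff.2 fun i => ?_
  cases i with
  | zero => exact measurable_fst
  | succ i => exact (measurable_pi_apply i).comp measurable_snd

lemma sum_range_cons (x : ℝ≥0∞) (v : ℕ → ℝ≥0∞) (k : ℕ) :
    ∑ i ∈ Finset.range (k + 1), cons x v i = x + ∑ i ∈ Finset.range k, v i := by
  rw [Finset.sum_range_succ', add_comm]
  rfl

lemma count_cons_of_le {t : ℝ≥0} {x : ℝ≥0∞} (hx : x ≤ t) (v : ℕ → ℝ≥0∞) :
    count t (cons x v) = count (t - x.toNNReal) v + 1 := by
  lift x to ℝ≥0 using (hx.trans_lt ENNReal.coe_lt_top).ne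
  have hx' : x ≤ t := by exact_mod_cast hx
  have hset : {n : ℕ | ∑ i ∈ Finset.range (n + 1), cons x v i ≤ (t : ℝ≥0∞)}
      = insert 0 (Nat.succ '' {n : ℕ | ∑ i ∈ Finset.range (n + 1), v i
        ≤ ((t - x : ℝ≥0) : ℝ≥0∞)}) := by
    ext n
    cases n with
    | zero => simpa [cons] using hx
    | succ n =>
      simp only [mem_ofPred_eq, sum_range_cons, mem_insert_iff, Nat.succ_ne_zero, false_or,
        Nat.succ_eq_add_one, mem_image, Nat.add_right_cancel_iff, exists_eq_right,
        ENNReal.coe_sub]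
      rw [ENNReal.le_sub_iff_add_le_left ENNReal.coe_ne_top hx]
  rw [count, hset, encard_insert_of_notMem (by simp), (Nat.succ_injective).encard_image]
  rfl

lemma count_cons_of_lt {t : ℝ≥0} {x : ℝ≥0∞} (hx : t < x) (v : ℕ → ℝ≥0∞) :
    count t (cons x v) = 0 := by
  rw [count, encard_eq_zero, eq_empty_iff_forall_notMem]
  intro n hn
  rw [mem_ofPred_eq, sum_range_cons] at hn
  exact absurd ((le_self_add).trans hn) (not_le.2 hx)

/-- The waiting times seen from time `t`, if exactly `k` arrivals occur in `[0,t]`. -/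
def after (t : ℝ≥0) (k : ℕ) (w : ℕ → ℝ≥0∞) : ℕ → ℝ≥0∞ :=
  cons (∑ i ∈ Finset.range (k + 1), w i - t) fun i => w (k + 1 + i)

lemma measurable_after (t : ℝ≥0) (k : ℕ) : Measurable (after t k) := by
  refine measurable_cons.comp (Measurable.prodMk ?_ ?_)
  · exact (Finset.measurable_fun_sum _ fun i _ => measurable_pi_apply i).sub_const _
  · exact measurable_pi_iff.2 fun i => measurable_pi_apply _

lemma after_zero_cons (t : ℝ≥0) (x : ℝ≥0∞) (v : ℕ → ℝ≥0∞) :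
    after t 0 (cons x v) = cons (x - t) v := by
  unfold after
  rw [sum_range_cons, Finset.sum_range_zero, add_zero]
  congr 1
  funext i
  rw [zero_add, add_comm]
  rfl

lemma after_succ_cons {t : ℝ≥0} {x : ℝ≥0∞} (hx : x ≤ t) (k : ℕ) (v : ℕ → ℝ≥0∞) :
    after t (k + 1) (cons x v) = after (t - x.toNNReal) k v := by
  lift x to ℝ≥0 using (hx.trans_lt ENNReal.coe_lt_top).ne
  unfold after
  rw [sum_range_cons]
  congr 1
  · rw [ENNReal.toNNReal_coe, ENNReal.coe_sub]
    conv_lhs => rw [← add_tsub_cancel_of_le hx, tsub_add_eq_tsub_tsub,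
      ENNReal.add_sub_cancel_left ENNReal.coe_ne_top]
  · funext i
    rw [show k + 1 + 1 + i = (k + 1 + i) + 1 by ring]
    rfl

lemma cons_head_tail (w : ℕ → ℝ≥0∞) : cons (w 0) (fun i => w (i + 1)) = w := by
  funext i
  cases i <;> rfl

/-- Each of the k arrivals is stripped off by replacing t with t - x, x being the first waiting
time. Once none is left in [0,t], restarting only shortens the first waiting time by t. -/
lemma count_add {t : ℝ≥0} {k : ℕ} {w : ℕ → ℝ≥0∞} (h : count t w = k) (s : ℝ≥0) :
    count (t + s) w = k + count s (after t k w) := by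
  induction k generalizing t w with
  | zero =>
    rw [← cons_head_tail w] at h ⊢
    generalize w 0 = x at h ⊢
    generalize (fun i => w (i + 1)) = v at h ⊢
    have hx : t < x := by
      by_contra hx
      rw [count_cons_of_le (not_lt.1 hx)] at h
      simp at h
    rw [after_zero_cons, Nat.cast_zero, zero_add]
    rcases le_or_gt x ((t + s : ℝ≥0) : ℝ≥0∞) with hxs | hxs
    · have hxs' : x - t ≤ s := by rw [tsub_le_iff_left]; exact_mod_cast hxs
      rw [count_cons_of_le hxs, count_cons_of_le hxs']
      lift x to ℝ≥0 using (hxs.trans_lt ENNReal.coe_lt_top).ne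
      congr 2
      rw [← ENNReal.coe_sub, ENNReal.toNNReal_coe, ENNReal.toNNReal_coe]
      have h1 : t ≤ x := by exact_mod_cast hx.le
      have h2 : x ≤ t + s := by exact_mod_cast hxs
      have h3 : x - t ≤ s := tsub_le_iff_left.2 h2
      rw [← NNReal.coe_inj]
      push_cast [NNReal.coe_sub h1, NNReal.coe_sub h2, NNReal.coe_sub h3]
      ring
    · have hxs' : s < x - t := by
        rw [lt_tsub_iff_right, add_comm]; exact_mod_cast hxs
      rw [count_cons_of_lt hxs, count_cons_of_lt hxs']
  | succ k ih =>
    rw [← cons_head_tail w] at h ⊢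
    generalize w 0 = x at h ⊢
    generalize (fun i => w (i + 1)) = v at h ⊢
    have hx : x ≤ t := by
      by_contra hx
      rw [count_cons_of_lt (not_le.1 hx), ← Nat.cast_zero, Nat.cast_inj] at h
      omega
    have hxs : x ≤ ((t + s : ℝ≥0) : ℝ≥0∞) := hx.trans (by simp)
    rw [count_cons_of_le hx, Nat.cast_add, Nat.cast_one] at h
    have h' : count (t - x.toNNReal) v = k := by
      exact (ENat.add_left_injective_of_ne_top ENat.one_ne_top) h
    have hx2 : x.toNNReal ≤ t := by
      simpa using ENNReal.toNNReal_mono ENNReal.coe_ne_top hx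
    rw [count_cons_of_le hxs, after_succ_cons hx, ← tsub_add_eq_add_tsub hx2, ih h']
    push_cast
    ring

/-- The law of an i.i.d. sequence of exponential waiting times. -/
def expSeq (θ : ℝ≥0) : Measure (ℕ → ℝ≥0∞) := Measure.infinitePi fun _ => expLaw θ

lemma eq_infinitePi_of_range {μ : Measure ℝ≥0∞} [IsProbabilityMeasure μ]
    {κ : Measure (ℕ → ℝ≥0∞)}
    (h : ∀ (n : ℕ) (t : ℕ → Set ℝ≥0∞), (∀ i, MeasurableSet (t i)) →
      κ {w | ∀ i < n, w i ∈ t i} = ∏ i ∈ Finset.range n, μ (t i)) :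
    κ = Measure.infinitePi fun _ => μ := by
  classical
  refine Measure.eq_infinitePi _ fun s t ht => ?_
  obtain ⟨n, hn⟩ := s.exists_nat_subset_range
  have h1 := h n (fun i => if i ∈ s then t i else univ) fun i => by
    by_cases hi : i ∈ s <;> simp [hi, ht]
  have h2 : {w : ℕ → ℝ≥0∞ | ∀ i < n, w i ∈ if i ∈ s then t i else univ} = Set.pi s t := by
    ext w
    simp only [mem_ofPred_eq, Set.mem_pi, Finset.mem_coe]
    constructor
    · intro hw i hi
      simpa [hi] using hw i (Finset.mem_range.1 (hn hi))
    · intro hw i _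
      split_ifs with hi
      · exact hw i hi
      · trivial
  rw [← h2, h1, ← Finset.prod_subset hn]
  · exact Finset.prod_congr rfl fun i hi => by simp [hi]
  · intro i _ hi
    simp [hi]

variable {θ : ℝ≥0}

lemma isProbabilityMeasure_expSeq (hθ : 0 < θ) : IsProbabilityMeasure (expSeq θ) := by
  have := isProbabilityMeasure_expLaw hθ
  unfold expSeq
  infer_instance

/-- This permits integrating over the first waiting time and the remaining sequence separately. -/
lemma map_cons_expSeq (hθ : 0 < θ) :
    ((expLaw θ).prod (expSeq θ)).map (fun q => cons q.1 q.2) = expSeq θ := by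
  have := isProbabilityMeasure_expLaw hθ
  have := isProbabilityMeasure_expSeq hθ
  refine eq_infinitePi_of_range fun n t ht => ?_
  have hms : MeasurableSet {w : ℕ → ℝ≥0∞ | ∀ i < n, w i ∈ t i} := by
    simp only [ofPred_forall]
    exact MeasurableSet.iInter fun i => MeasurableSet.iInter fun _ => measurable_pi_apply i (ht i)
  rw [Measure.map_apply measurable_cons hms]
  cases n with
  | zero => simp
  | succ n =>
    have h1 : (fun q : ℝ≥0∞ × (ℕ → ℝ≥0∞) => cons q.1 q.2) ⁻¹' {w | ∀ i < n + 1, w i ∈ t i}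
        = t 0 ×ˢ Set.pi (Finset.range n : Set ℕ) fun i => t (i + 1) := by
      ext ⟨x, v⟩
      simp only [mem_preimage, mem_ofPred_eq, mem_prod, Set.mem_pi, Finset.coe_range, mem_Iio]
      constructor
      · intro h
        exact ⟨h 0 (by omega), fun i hi => h (i + 1) (by omega)⟩
      · rintro ⟨h1, h2⟩ i hi
        cases i with
        | zero => exact h1
        | succ i => exact h2 i (by omega)
    rw [h1, Measure.prod_prod, expSeq, Measure.infinitePi_pi _ fun i _ => ht (i + 1),
      Finset.prod_range_succ', mul_comm]

/-- The Markov property of the Poisson process at a fixed time. -/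
lemma expSeq_count_eq_and_after_mem (hθ : 0 < θ) (t : ℝ≥0) (k : ℕ) {B : Set (ℕ → ℝ≥0∞)}
    (hB : MeasurableSet B) :
    expSeq θ {w | count t w = k ∧ after t k w ∈ B} = poissonMeasure (θ * t) {k} * expSeq θ B := by
  have := isProbabilityMeasure_expLaw hθ
  have := isProbabilityMeasure_expSeq hθ
  have hms : ∀ (t : ℝ≥0) (k : ℕ), MeasurableSet {w | count t w = k ∧ after t k w ∈ B} :=
    fun t k => (measurable_count t (measurableSet_singleton (k : ℕ∞))).inter
      (measurable_after t k hB)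
  -- With no arrival, the later waiting times are frozen and memorylessness acts on the first one.
  -- Otherwise the first waiting time x ≤ t is frozen, the induction hypothesis applies at t - x,
  -- and the Poisson weights integrate up.
  induction k generalizing t with
  | zero =>
    have hpre : MeasurableSet ((fun q : ℝ≥0∞ × (ℕ → ℝ≥0∞) => cons q.1 q.2) ⁻¹' B) :=
      measurable_cons hB
    have happ : ∀ {E : Set (ℕ → ℝ≥0∞)}, MeasurableSet E → expSeq θ E
        = ∫⁻ v, expLaw θ ((fun x => (x, v)) ⁻¹'
          ((fun q : ℝ≥0∞ × (ℕ → ℝ≥0∞) => cons q.1 q.2) ⁻¹' E)) ∂expSeq θ := fun {E} hE => by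
      conv_lhs => rw [← map_cons_expSeq hθ]
      rw [Measure.map_apply measurable_cons hE, Measure.prod_apply_symm (measurable_cons hE)]
    rw [happ (hms t 0), happ hB, ← lintegral_const_mul _ (measurable_measure_prodMk_right hpre)]
    refine lintegral_congr fun v => ?_
    have h1 : (fun x => (x, v)) ⁻¹' ((fun q : ℝ≥0∞ × (ℕ → ℝ≥0∞) => cons q.1 q.2) ⁻¹'
        {w | count t w = (0 : ℕ) ∧ after t 0 w ∈ B}) = {x : ℝ≥0∞ | t < x ∧ x - t ∈ (fun x => (x, v)) ⁻¹'
          ((fun q : ℝ≥0∞ × (ℕ → ℝ≥0∞) => cons q.1 q.2) ⁻¹' B)} := by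
      ext x
      simp only [mem_preimage, mem_ofPred_eq, after_zero_cons]
      refine and_congr_left fun _ => ⟨fun h => ?_, fun h => ?_⟩
      · by_contra hx
        rw [count_cons_of_le (not_lt.1 hx)] at h
        simp at h
      · rw [count_cons_of_lt h, Nat.cast_zero]
    rw [h1, expLaw_memoryless hθ t (measurable_prodMk_right hpre), poissonMeasure_singleton]
    simp
  | succ k ih =>
    rw [← lintegral_expLaw_poisson, ← lintegral_mul_const' _ _ (measure_ne_top _ _)]
    conv_lhs => rw [← map_cons_expSeq hθ]
    rw [Measure.map_apply measurable_cons (hms t (k + 1)),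
      Measure.prod_apply (measurable_cons (hms t (k + 1)))]
    refine lintegral_congr fun x => ?_
    by_cases hx : x ≤ t
    · rw [indicator_of_mem (by exact hx), ← ih (t - x.toNNReal)]
      congr 1
      ext v
      simp only [mem_preimage, mem_ofPred_eq, after_succ_cons hx, count_cons_of_le hx,
        Nat.cast_add, Nat.cast_one]
      refine and_congr_left fun _ => ⟨fun h => ?_, fun h => by rw [h]⟩
      exact (ENat.add_left_injective_of_ne_top ENat.one_ne_top) h
    · rw [indicator_of_notMem (by exact hx), zero_mul]
      refine measure_mono_null (fun v hv => ?_) measure_empty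
      simp only [mem_preimage, mem_ofPred_eq, count_cons_of_lt (not_le.1 hx)] at hv
      have h0 := hv.1
      rw [← Nat.cast_zero, Nat.cast_inj] at h0
      omega

end

/-! ### Exponential waiting times give a Poisson process. -/

section

open Filter Topology

/-- The Poisson distribution on `ℕ ∪ {∞}`. -/
def poissonENat (r : ℝ≥0) : Measure ℕ∞ := (poissonMeasure r).map fun k : ℕ => (k : ℕ∞)

lemma isProbabilityMeasure_poissonENat (r : ℝ≥0) : IsProbabilityMeasure (poissonENat r) :=
  Measure.isProbabilityMeasure_map (by fun_prop)

lemma poissonENat_eq_tsum (r : ℝ≥0) (A : Set ℕ∞) :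
    poissonENat r A = ∑' k : ℕ, ((fun k : ℕ => (k : ℕ∞)) ⁻¹' A).indicator
      (fun k => poissonMeasure r {k}) k := by
  rw [poissonENat, Measure.map_apply (by fun_prop) (MeasurableSet.of_discrete),
    Measure.tsum_indicator_apply_singleton _ _ MeasurableSet.of_discrete]

variable {θ : ℝ≥0}

/-- The Markov property gives the masses of finite k, hence one inequality of measures. As both have
mass 1 they agree, and ⊤ is null. -/
lemma map_count_expSeq (hθ : 0 < θ) (t : ℝ≥0) :
    (expSeq θ).map (count t) = poissonENat (θ * t) := by
  have := isProbabilityMeasure_expSeq hθ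
  have := isProbabilityMeasure_poissonENat (θ * t)
  have := Measure.isProbabilityMeasure_map (μ := expSeq θ) (measurable_count t).aemeasurable
  have hsing : ∀ k : ℕ, (expSeq θ).map (count t) {(k : ℕ∞)} = poissonMeasure (θ * t) {k} := by
    intro k
    rw [Measure.map_apply (measurable_count t) (measurableSet_singleton _)]
    have := expSeq_count_eq_and_after_mem hθ t k MeasurableSet.univ
    simp only [mem_univ, and_true, measure_univ, mul_one] at this
    exact this
  symm
  refine Measure.eq_of_le_of_measure_univ_eq (Measure.le_iff.2 fun A hA => ?_) (by simp)
  rw [poissonENat_eq_tsum, ← Measure.tsum_indicator_apply_singleton _ A hA]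
  refine le_trans (le_of_eq ?_) (ENNReal.tsum_comp_le_tsum_of_injective
    (f := fun k : ℕ => (k : ℕ∞)) Nat.cast_injective _)
  refine tsum_congr fun k => ?_
  by_cases hk : (k : ℕ∞) ∈ A
  · rw [indicator_of_mem hk, indicator_of_mem (by exact hk), hsing]
  · rw [indicator_of_notMem hk, indicator_of_notMem (by exact hk)]

lemma ae_count_ne_top (hθ : 0 < θ) (t : ℝ≥0) : ∀ᵐ w ∂expSeq θ, count t w ≠ ⊤ := by
  rw [ae_iff]
  have h := congrArg (fun κ : Measure ℕ∞ => κ {⊤}) (map_count_expSeq hθ t)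
  simp only [Measure.map_apply (measurable_count t) (measurableSet_singleton _)] at h
  have h2 : poissonENat (θ * t) {⊤} = 0 := by
    rw [poissonENat_eq_tsum, ENNReal.tsum_eq_zero]
    intro k
    exact indicator_of_notMem (by simp) _
  rw [h2] at h
  simp only [not_not]
  exact h

lemma expSeq_count_mem_and_after_mem (hθ : 0 < θ) (t : ℝ≥0) (A : Set ℕ∞) {B : Set (ℕ → ℝ≥0∞)}
    (hB : MeasurableSet B) :
    expSeq θ {w | ∃ k : ℕ, count t w = k ∧ (k : ℕ∞) ∈ A ∧ after t k w ∈ B}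
      = poissonENat (θ * t) A * expSeq θ B := by
  have hset : {w | ∃ k : ℕ, count t w = k ∧ (k : ℕ∞) ∈ A ∧ after t k w ∈ B}
      = ⋃ k : ℕ, {w | (k : ℕ∞) ∈ A ∧ (count t w = k ∧ after t k w ∈ B)} := by
    ext w
    simp only [mem_ofPred_eq, mem_iUnion]
    exact exists_congr fun k => and_left_comm
  have hms : ∀ k : ℕ, MeasurableSet {w | (k : ℕ∞) ∈ A ∧ (count t w = k ∧ after t k w ∈ B)} :=
    fun k => (MeasurableSet.const _).inter
      ((measurable_count t (measurableSet_singleton (k : ℕ∞))).inter (measurable_after t k hB))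
  rw [hset, measure_iUnion _ hms, poissonENat_eq_tsum, ← ENNReal.tsum_mul_right]
  · refine tsum_congr fun k => ?_
    by_cases hk : (k : ℕ∞) ∈ A
    · simp only [hk, true_and]
      rw [expSeq_count_eq_and_after_mem hθ t k hB, indicator_of_mem (by exact hk)]
    · simp [hk]
  · intro i j hij
    refine disjoint_left.2 fun w h1 h2 => hij ?_
    exact Nat.cast_injective (R := ℕ∞) (h1.2.1.symm.trans h2.2.1)

/-- After restarting at `t 0`, the later increments are those of a fresh exponential sequence at the
times t (i + 1) - t 0, independent of the count at `t 0`; so induction on the number of times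
applies. -/
lemma expSeq_increments (hθ : 0 < θ) (n : ℕ) (t : ℕ → ℝ≥0) (ht : Monotone t) (A : ℕ → Set ℕ∞) :
    expSeq θ {w | count (t 0) w ∈ A 0 ∧ ∀ i < n, count (t (i + 1)) w - count (t i) w ∈ A (i + 1)}
      = poissonENat (θ * t 0) (A 0)
        * ∏ i ∈ Finset.range n, poissonENat (θ * (t (i + 1) - t i)) (A (i + 1)) := by
  have := isProbabilityMeasure_expSeq hθ
  induction n generalizing t A with
  | zero =>
    simp only [not_lt_zero, false_imp_iff, implies_true, and_true, Finset.range_zero,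
      Finset.prod_empty, mul_one]
    rw [← map_count_expSeq hθ, Measure.map_apply (measurable_count _) MeasurableSet.of_discrete]
    rfl
  | succ n ih =>
    set s : ℕ → ℝ≥0 := fun i => t (i + 1) - t 0 with hs
    have hsm : Monotone s := fun i j hij => tsub_le_tsub_right (ht (by omega)) _
    have hts : ∀ i, t (i + 1) = t 0 + s i := fun i => (add_tsub_cancel_of_le (ht (by omega))).symm
    set B : Set (ℕ → ℝ≥0∞) := {w | count (s 0) w ∈ A 1 ∧
      ∀ i < n, count (s (i + 1)) w - count (s i) w ∈ A (i + 2)} with hB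
    have hBm : MeasurableSet B := by
      have hincr : MeasurableSet {w : ℕ → ℝ≥0∞ |
          ∀ i < n, count (s (i + 1)) w - count (s i) w ∈ A (i + 2)} := by
        simp only [ofPred_forall]
        exact MeasurableSet.iInter fun i => MeasurableSet.iInter fun _ =>
        ((measurable_count _).prodMk (measurable_count _))
          (MeasurableSet.of_discrete (s := {q : ℕ∞ × ℕ∞ | q.1 - q.2 ∈ A (i + 2)}))
      exact (measurable_count _ (MeasurableSet.of_discrete)).inter hincr
    have hih := ih s hsm fun i => A (i + 1)
    have hmarkov := expSeq_count_mem_and_after_mem hθ (t 0) (A 0) hBm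
    have hprod : ∀ i, s (i + 1) - s i = t (i + 1 + 1) - t (i + 1) := fun i => by
      rw [hts (i + 1), hts i, add_tsub_add_eq_tsub_left]
    simp only [hprod] at hih
    rw [Finset.prod_range_succ', mul_comm (∏ i ∈ Finset.range n, _), ← hih, ← hmarkov]
    -- The events agree only almost everywhere: a restart needs a finite count at `t 0`.
    refine measure_congr ?_
    filter_upwards [ae_count_ne_top hθ (t 0)] with w hw
    obtain ⟨k, hk⟩ := ENat.ne_top_iff_exists.1 hw
    have hadd : ∀ i, count (t (i + 1)) w = k + count (s i) (after (t 0) k w) := fun i => by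
      rw [hts i, count_add hk.symm]
    have hfirst : count (t 1) w - count (t 0) w = count (s 0) (after (t 0) k w) := by
      rw [hadd 0, ← hk]
      exact (ENat.addLECancellable_of_ne_top (ENat.natCast_ne_top k)).add_tsub_cancel_left
    have hincr : ∀ i, count (t (i + 1 + 1)) w - count (t (i + 1)) w
        = count (s (i + 1)) (after (t 0) k w) - count (s i) (after (t 0) k w) := fun i => by
      rw [hadd (i + 1), hadd i]
      rw [tsub_add_eq_tsub_tsub,
        (ENat.addLECancellable_of_ne_top (ENat.natCast_ne_top k)).add_tsub_cancel_left]
    refine propext ?_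
    change (count (t 0) w ∈ A 0 ∧ ∀ i < n + 1, count (t (i + 1)) w - count (t i) w ∈ A (i + 1)) ↔
      ∃ k : ℕ, count (t 0) w = k ∧ (k : ℕ∞) ∈ A 0 ∧ after (t 0) k w ∈ B
    constructor
    · rintro ⟨h0, h⟩
      refine ⟨k, hk.symm, by rwa [hk], ?_, fun i hi => ?_⟩
      · rw [← hfirst]; exact h 0 (by omega)
      · rw [← hincr]; exact h (i + 1) (by omega)
    · rintro ⟨k', hk', hA, h1, h2⟩
      have : k = k' := Nat.cast_injective (R := ℕ∞) (hk.trans hk')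
      subst this
      refine ⟨by rwa [← hk], fun i hi => ?_⟩
      cases i with
      | zero => rw [zero_add, hfirst]; exact h1
      | succ i => rw [hincr]; exact h2 i (by omega)

lemma ae_pos_of_expSeq (hθ : 0 < θ) : ∀ᵐ w ∂expSeq θ, ∀ i, 0 < w i := by
  have := isProbabilityMeasure_expLaw hθ
  rw [ae_all_iff]
  intro i
  have h0 : expLaw θ {0} = 0 := by
    have := expLaw_Iic hθ 0
    rw [show ({0} : Set ℝ≥0∞) = Iic ((0 : ℝ≥0) : ℝ≥0∞) by ext; simp]
    simpa using this
  have hmap : (expSeq θ).map (fun w => w i) = expLaw θ := Measure.infinitePi_map_eval _ i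
  rw [← hmap, Measure.map_apply (measurable_pi_apply i) (measurableSet_singleton _)] at h0
  simp only [ae_iff, pos_iff_ne_zero, not_not]
  exact h0

variable {Ω : Type*} {T : ℕ → Ω → ℝ≥0∞}

lemma measurable_renewalProcess [MeasurableSpace Ω] (hT : ∀ i, Measurable (T i)) (t : ℝ≥0) :
    Measurable (renewalProcess T t) :=
  (measurable_count t).comp (measurable_pi_iff.2 hT)

lemma succ_le_renewalProcess_iff (T : ℕ → Ω → ℝ≥0∞) (t : ℝ≥0) (ω : Ω) (k : ℕ) :
    ((k + 1 : ℕ) : ℕ∞) ≤ renewalProcess T t ω ↔ arrival T k ω ≤ t :=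
  succ_le_count_iff t _ k

/-- Paths are constant just to the right of t: if k arrivals are counted at t, the arrival of index
k lies strictly later. -/
lemma renewalProcess_right_continuous (T : ℕ → Ω → ℝ≥0∞) (ω : Ω) (t : ℝ≥0) :
    ContinuousWithinAt (fun s => renewalProcess T s ω) (Ici t) t := by
  have hmono : Monotone fun s => renewalProcess T s ω := count_mono _
  have hev : ∀ᶠ s in 𝓝[≥] t, renewalProcess T s ω = renewalProcess T t ω := by
    by_cases htop : renewalProcess T t ω = ⊤
    · filter_upwards [self_mem_nhdsWithin] with s hs
      rw [htop]
      exact top_le_iff.1 (htop ▸ hmono hs)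
    · obtain ⟨k, hk⟩ := ENat.ne_top_iff_exists.1 htop
      have hlt : (t : ℝ≥0∞) < arrival T k ω := by
        rw [← not_le, ← succ_le_renewalProcess_iff, ← hk, Nat.cast_le]
        omega
      have h1 : ∀ᶠ s : ℝ≥0 in 𝓝 t, (s : ℝ≥0∞) < arrival T k ω :=
        ENNReal.continuous_coe.continuousAt.eventually_lt_const hlt
      filter_upwards [self_mem_nhdsWithin, mem_nhdsWithin_of_mem_nhds h1] with s hs h2
      refine le_antisymm ?_ (hmono hs)
      rw [← hk]
      have h3 : ¬ ((k + 1 : ℕ) : ℕ∞) ≤ renewalProcess T s ω := by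
        rw [succ_le_renewalProcess_iff]
        exact not_le.2 h2
      rw [not_le, Nat.cast_add, Nat.cast_one] at h3
      exact Order.le_of_lt_add_one h3
  exact tendsto_const_nhds.congr' (hev.mono fun _ h => h.symm)

/-- With at least two arrivals up to t, a positive waiting time puts the last but one strictly
before t, so the left limit misses at most one arrival. -/
lemma renewalProcess_jump_le_one {ω : Ω} (hpos : ∀ i, 0 < T i ω)
    (t : ℝ≥0) (hfin : renewalProcess T t ω ≠ ⊤) :
    renewalProcess T t ω - Function.leftLim (fun s => renewalProcess T s ω) t ≤ 1 := by
  have hmono : Monotone fun s => renewalProcess T s ω := count_mono _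
  obtain ⟨m, hm⟩ := ENat.ne_top_iff_exists.1 hfin
  rcases m with _ | _ | k
  · rw [← hm]; simp
  · rw [← hm]; exact tsub_le_self
  · have h1 : arrival T (k + 1) ω ≤ t := by
      rw [← succ_le_renewalProcess_iff, ← hm]
    have h2 : arrival T (k + 1) ω = arrival T k ω + T (k + 1) ω := Finset.sum_range_succ _ _
    have hktop : arrival T k ω ≠ ∞ :=
      ((arrival_mono T ω (Nat.le_succ k)).trans h1 |>.trans_lt ENNReal.coe_lt_top).ne
    have h3 : arrival T k ω < t := by
      refine lt_of_lt_of_le ?_ h1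
      rw [h2]
      exact ENNReal.lt_add_right hktop (hpos _).ne'
    obtain ⟨s, hs⟩ := (⟨_, ENNReal.coe_toNNReal hktop⟩ : ∃ s : ℝ≥0, (s : ℝ≥0∞) = arrival T k ω)
    have hst : s < t := by rw [← hs] at h3; exact_mod_cast h3
    have h4 : ((k + 1 : ℕ) : ℕ∞) ≤ renewalProcess T s ω := by
      rw [succ_le_renewalProcess_iff, hs]
    have h5 := h4.trans (hmono.le_leftLim hst)
    rw [tsub_le_iff_left, ← hm, Nat.cast_add (k + 1) 1, Nat.cast_one]
    gcongr

/-- The renewal process with i.i.d. exponential waiting times is a Poisson process. -/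
lemma isHPP_of_map_eq_expSeq [MeasurableSpace Ω] {P : Measure Ω} [IsProbabilityMeasure P] (hθ : 0 < θ) (hT : ∀ i, Measurable (T i))
    (hlaw : P.map (fun ω i => T i ω) = expSeq θ) : IsHPP (renewalProcess T) θ P := by
  have hTm : Measurable fun ω i => T i ω := measurable_pi_iff.2 hT
  have htransfer : ∀ {q : (ℕ → ℝ≥0∞) → Prop}, (∀ᵐ w ∂expSeq θ, q w) →
      ∀ᵐ ω ∂P, q fun i => T i ω := fun {q} h => by
    rw [← hlaw] at h
    exact ae_of_ae_map hTm.aemeasurable h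
  have hpos := htransfer (ae_pos_of_expSeq hθ)
  have hmono : ∀ ω, Monotone fun t => renewalProcess T t ω := fun ω => count_mono _
  have hfin : ∀ᵐ ω ∂P, ∀ t, renewalProcess T t ω < ⊤ := by
    have h1 : ∀ᵐ ω ∂P, ∀ n : ℕ, renewalProcess T n ω ≠ ⊤ := by
      rw [ae_all_iff]
      exact fun n => htransfer (ae_count_ne_top hθ n)
    filter_upwards [h1] with ω hω t
    obtain ⟨n, hn⟩ := exists_nat_ge t
    exact (hmono ω hn).trans_lt (lt_top_iff_ne_top.2 (hω n))
  have hm := measurable_renewalProcess hT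
  have hsub : ∀ s t, Measurable fun ω => renewalProcess T t ω - renewalProcess T s ω :=
    fun s t => (Measurable.of_discrete (f := fun q : ℕ∞ × ℕ∞ => q.1 - q.2)).comp
      ((hm t).prodMk (hm s))
  have hincr : ∀ (n : ℕ) (t : ℕ → ℝ≥0), Monotone t → ∀ A : ℕ → Set ℕ∞,
      P {ω | ∀ i < n, renewalProcess T (t (i + 1)) ω - renewalProcess T (t i) ω ∈ A i}
        = ∏ i ∈ Finset.range n, poissonENat (θ * (t (i + 1) - t i)) (A i) := by
    intro n t ht A
    have := isProbabilityMeasure_poissonENat (θ * t 0)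
    have h1 := expSeq_increments hθ n t ht fun i => if i = 0 then univ else A (i - 1)
    simp only [if_true, mem_univ, true_and, measure_univ, one_mul, Nat.add_eq_zero_iff,
      one_ne_zero, and_false, if_false, Nat.add_sub_cancel] at h1
    rw [← h1, ← hlaw, Measure.map_apply hTm]
    · rfl
    · simp only [ofPred_forall]
      exact MeasurableSet.iInter fun i => MeasurableSet.iInter fun _ =>
        ((measurable_count _).prodMk (measurable_count _))
          (MeasurableSet.of_discrete (s := {q : ℕ∞ × ℕ∞ | q.1 - q.2 ∈ A i}))
  refine ⟨hθ, hm, hmono, fun ω t => renewalProcess_right_continuous T ω t, hfin, ?_, ?_, ?_, ?_⟩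
  · filter_upwards [hpos, hfin] with ω h1 h2 t
    exact renewalProcess_jump_le_one h1 t (h2 t).ne
  · filter_upwards [hpos] with ω h1
    have h2 : ¬ ((0 + 1 : ℕ) : ℕ∞) ≤ renewalProcess T 0 ω := by
      rw [succ_le_renewalProcess_iff, arrival_zero]
      simpa using (h1 0).ne'
    rw [not_le, zero_add, Nat.cast_one] at h2
    exact Order.lt_one_iff.1 h2
  · rw [hasIndepIncrements_iff_nat]
    intro t ht
    rw [iIndepFun_iff_measure_inter_preimage_eq_mul]
    intro S A _
    classical
    obtain ⟨n, hn⟩ := S.exists_nat_subset_range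
    have hsingle : ∀ i, P ((fun ω => renewalProcess T (t (i + 1)) ω - renewalProcess T (t i) ω)
        ⁻¹' A i) = poissonENat (θ * (t (i + 1) - t i)) (A i) := fun i => by
      have h1 := hincr 1 (fun j => t (i + j)) (fun a b hab => ht (by omega)) fun _ => A i
      simpa [preimage] using h1
    have h1 := hincr n t ht fun i => if i ∈ S then A i else univ
    have hset : (⋂ i ∈ S, (fun ω => renewalProcess T (t (i + 1)) ω - renewalProcess T (t i) ω)
        ⁻¹' A i) = {ω | ∀ i < n, renewalProcess T (t (i + 1)) ω - renewalProcess T (t i) ω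
          ∈ if i ∈ S then A i else univ} := by
      ext ω
      simp only [mem_iInter, mem_preimage, mem_ofPred_eq]
      constructor
      · intro h i _
        split_ifs with hi
        · exact h i hi
        · trivial
      · intro h i hi
        simpa [hi] using h i (Finset.mem_range.1 (hn hi))
    rw [hset, h1, ← Finset.prod_subset hn]
    · exact Finset.prod_congr rfl fun i hi => by rw [if_pos hi, hsingle]
    · intro i _ hi
      have := isProbabilityMeasure_poissonENat (θ * (t (i + 1) - t i))
      rw [if_neg hi, measure_univ]
  · intro s t hst
    refine ⟨(hsub s t).aemeasurable, Measure.ext fun A hA => ?_⟩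
    have hmn : Monotone fun i : ℕ => if i = 0 then s else t := by
      intro i j hij
      dsimp only
      split_ifs with h1 h2
      · exact le_rfl
      · exact hst
      · omega
      · exact le_rfl
    have h1 := hincr 1 _ hmn fun _ => A
    rw [Measure.map_apply (hsub s t) hA]
    simpa [poissonENat, preimage] using h1

end

/-! ### Recovering exponential waiting times from a Poisson process, and conclusion. -/

section

variable {Ω : Type*} [MeasurableSpace Ω] {P : Measure Ω} {T : ℕ → Ω → ℝ≥0∞}
  {θ : ℝ≥0}

lemma IsHPP.map_eq_poissonENat {N : ℝ≥0 → Ω → ℕ∞} (hN : IsHPP N θ P) (t : ℝ≥0) :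
    P.map (N t) = poissonENat (θ * t) := by
  have h1 := (hN.poisson_increments 0 t zero_le).map_eq
  rw [tsub_zero] at h1
  rw [poissonENat, ← h1]
  refine Measure.map_congr ?_
  filter_upwards [hN.start_zero] with ω hω
  rw [hω, tsub_zero]

lemma laplace_arrival_one (hT : ∀ i, Measurable (T i)) (hTi : iIndepFun T P)
    (hTid : ∀ j, 1 ≤ j → IdentDistrib (T j) (T 1) P P) (n : ℕ) :
    laplace P (arrival T 1) n = laplace P (T 0) n * laplace P (T 1) n := by
  have h := lintegral_expNeg_arrival hT hTi hTid 0 n 0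
  simp only [pow_zero, one_mul, zero_add, pow_one] at h
  rw [laplace, h, ENNReal.toReal_mul]
  rfl

lemma laplace_congr_of_map_eq {Ω' : Type*} [MeasurableSpace Ω'] {P' : Measure Ω'}
    {Y : Ω → ℝ≥0∞} {Y' : Ω' → ℝ≥0∞} (hY : Measurable Y) (hY' : Measurable Y')
    (h : P.map Y = P'.map Y') (n : ℕ) : laplace P Y n = laplace P' Y' n := by
  rw [laplace, laplace, ← lintegral_map (measurable_expNeg.pow_const n) hY, h,
    lintegral_map (measurable_expNeg.pow_const n) hY']

lemma functional_eq_of_map_eq_expLaw {U V : Ω → ℝ≥0∞} (hU : Measurable U) (hV : Measurable V)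
    (hθ : 0 < θ) (hU' : P.map U = expLaw θ) (hV' : P.map V = expLaw θ) (a b : ℕ) :
    laplace P U (a + b) * (laplace P V a + laplace P V b - laplace P V a * laplace P V b)
      = laplace P U a * laplace P U b := by
  have hθ' : (0 : ℝ) < θ := hθ
  simp only [laplace_of_map_eq_expLaw hU hθ hU', laplace_of_map_eq_expLaw hV hθ hV']
  push_cast
  field_simp
  ring

variable [IsProbabilityMeasure P]

lemma map_eq_expSeq (hT : ∀ i, Measurable (T i)) (hTi : iIndepFun T P)
    (hTid : ∀ j, 1 ≤ j → IdentDistrib (T j) (T 1) P P)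
    (h0 : P.map (T 0) = expLaw θ) (h1 : P.map (T 1) = expLaw θ) :
    P.map (fun ω i => T i ω) = expSeq θ := by
  have hlaw : ∀ i, P.map (T i) = expLaw θ := fun i => by
    rcases Nat.eq_zero_or_pos i with rfl | hi
    · exact h0
    · rw [(hTid i hi).map_eq, h1]
  rw [(iIndepFun_iff_map_fun_eq_infinitePi_map hT).1 hTi, expSeq]
  simp_rw [hlaw]

/-- The events {S_k ≤ t} and {N_t ≥ k + 1} coincide, so the marginals of N fix the law of each
arrival. Comparison with the canonical exponential sequence avoids computing gamma laws. -/
lemma IsHPP.map_arrival_eq (hT : ∀ i, Measurable (T i)) (hN : IsHPP (renewalProcess T) θ P)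
    (k : ℕ) : P.map (arrival T k) = (expSeq θ).map (arrival (fun i w => w i) k) := by
  have hθ := hN.intensity_pos
  have := isProbabilityMeasure_expSeq hθ
  have hm := measurable_arrival hT k
  have hm' : Measurable (arrival (fun i (w : ℕ → ℝ≥0∞) => w i) k) :=
    measurable_arrival (fun i => measurable_pi_apply i) k
  have := Measure.isProbabilityMeasure_map (μ := P) hm.aemeasurable
  have := Measure.isProbabilityMeasure_map (μ := expSeq θ) hm'.aemeasurable
  refine Measure.ext_of_Iic _ _ fun t => ?_
  induction t with
  | top => simp
  | coe t =>
    have h1 : P.map (renewalProcess T t) (Ici ((k + 1 : ℕ) : ℕ∞))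
        = (expSeq θ).map (count t) (Ici ((k + 1 : ℕ) : ℕ∞)) := by
      rw [hN.map_eq_poissonENat, map_count_expSeq hθ]
    rw [Measure.map_apply (hN.measurable t) MeasurableSet.of_discrete,
      Measure.map_apply (measurable_count t) MeasurableSet.of_discrete] at h1
    rw [Measure.map_apply hm measurableSet_Iic, Measure.map_apply hm' measurableSet_Iic]
    convert h1 using 2
    · ext ω
      exact (succ_le_renewalProcess_iff T t ω k).symm
    · ext w
      exact (succ_le_count_iff t w k).symm

/-- The waiting times of a renewal process that is a Poisson process are exponential. -/
lemma IsHPP.map_eq_expLaw (hT : ∀ i, Measurable (T i)) (hTi : iIndepFun T P)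
    (hTid : ∀ j, 1 ≤ j → IdentDistrib (T j) (T 1) P P)
    (hN : IsHPP (renewalProcess T) θ P) :
    P.map (T 0) = expLaw θ ∧ P.map (T 1) = expLaw θ := by
  have hθ := hN.intensity_pos
  have := isProbabilityMeasure_expSeq hθ
  have := isProbabilityMeasure_expLaw hθ
  have hE : ∀ i, Measurable fun w : ℕ → ℝ≥0∞ => w i := fun i => measurable_pi_apply i
  have hEmap : ∀ i, (expSeq θ).map (fun w => w i) = expLaw θ := fun i =>
    Measure.infinitePi_map_eval _ i
  have hEi : iIndepFun (fun i (w : ℕ → ℝ≥0∞) => w i) (expSeq θ) := by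
    rw [iIndepFun_iff_map_fun_eq_infinitePi_map hE]
    simp_rw [hEmap]
    exact Measure.map_id
  have hEid : ∀ j, 1 ≤ j → IdentDistrib (fun w : ℕ → ℝ≥0∞ => w j) (fun w => w 1) (expSeq θ)
      (expSeq θ) := fun j _ =>
    ⟨(hE j).aemeasurable, (hE 1).aemeasurable, by rw [hEmap, hEmap]⟩
  have h0 : P.map (T 0) = expLaw θ := by
    have h1 := hN.map_arrival_eq hT 0
    rw [show arrival T 0 = T 0 from funext (arrival_zero T),
      show arrival (fun i (w : ℕ → ℝ≥0∞) => w i) 0 = fun w => w 0 from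
        funext (arrival_zero _), hEmap] at h1
    exact h1
  refine ⟨h0, map_eq_expLaw_of_laplace (hT 1) hθ fun n _ => ?_⟩
  -- The second arrival has a known transform, a product by independence; cancelling the nonzero
  -- transform of `T 0` leaves that of `T 1`.
  have h1 := laplace_congr_of_map_eq (measurable_arrival hT 1) (measurable_arrival hE 1)
    (hN.map_arrival_eq hT 1) n
  rw [laplace_arrival_one hT hTi hTid, laplace_arrival_one hE hEi hEid,
    laplace_of_map_eq_expLaw (hT 0) hθ h0, laplace_of_map_eq_expLaw (hE 0) hθ (hEmap 0),
    laplace_of_map_eq_expLaw (hE 1) hθ (hEmap 1)] at h1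
  have hθ' : (0 : ℝ) < θ := hθ
  exact mul_left_cancel₀ (by positivity) h1

lemma exists_isHPP_iff (hT : ∀ i, Measurable (T i)) (hTi : iIndepFun T P)
    (hTid : ∀ j, 1 ≤ j → IdentDistrib (T j) (T 1) P P) :
    (∃ θ : ℝ≥0, IsHPP (renewalProcess T) θ P) ↔
      ∃ θ : ℝ≥0, 0 < θ ∧ P.map (T 0) = expLaw θ ∧ P.map (T 1) = expLaw θ :=
  ⟨fun ⟨θ, hN⟩ => ⟨θ, hN.intensity_pos, hN.map_eq_expLaw hT hTi hTid⟩,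
    fun ⟨θ, hθ, h0, h1⟩ => ⟨θ, isHPP_of_map_eq_expSeq hθ hT (map_eq_expSeq hT hTi hTid h0 h1)⟩⟩

lemma eq_zero_ae_of_real_eq_one {Y : Ω → ℝ≥0∞} (hY : Measurable Y)
    (h : P.real {ω | Y ω = 0} = 1) : ∀ᵐ ω ∂P, Y ω = 0 := by
  rw [measureReal_def, ENNReal.toReal_eq_one_iff] at h
  have := (prob_compl_eq_zero_iff (hY (measurableSet_singleton 0))).2 h
  exact ae_iff.2 this

lemma exists_expLaw_of_nonArithmetic_or {U V : Ω → ℝ≥0∞} (hU : Measurable U) (hV : Measurable V)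
    (hess : ∀ ε : ℝ≥0, 0 < ε → 0 < P {ω | U ω < (ε : ℝ≥0∞)})
    (hor : NonArithmetic V P ∨ P {ω | U ω = 0} = 0)
    (h : ∀ a b : ℕ, laplace P U (a + b) *
      (laplace P V a + laplace P V b - laplace P V a * laplace P V b)
        = laplace P U a * laplace P U b) :
    ∃ θ : ℝ≥0, 0 < θ ∧ P.map U = expLaw θ ∧ P.map V = expLaw θ := by
  have hUV := laplace_eq_of_functional_eq hU hV hess h
  set m := P.real {ω | V ω = 0} with hm
  have hm0 : 0 ≤ m := measureReal_nonneg
  have hm1 : m ≤ 1 := measureReal_le_one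
  have hpos : ∀ n, 0 < laplace P U n := fun n => by
    obtain ⟨π, hπ, h1⟩ := exists_pow_mul_le_laplace hU hess (z := 1 / 2) (by norm_num) (by norm_num)
    exact lt_of_lt_of_le (by positivity) (h1 n)
  have hmzero : m = 0 := by
    rcases hor with hna | h0
    · by_contra hne
      rcases eq_or_lt_of_le hm1 with h1 | h1
      · refine not_nonArithmetic_of_mem_range (x := 0) ?_ hna
        filter_upwards [eq_zero_ae_of_real_eq_one hV h1] with ω hω
        exact ⟨0, by simp [hω]⟩
      · exact not_nonArithmetic_of_functional_eq hU hV (c := 1 - m) (by linarith)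
          (by linarith [lt_of_le_of_ne hm0 (Ne.symm hne)]) hpos hUV h hna
    -- Letting n → ∞ in l0 = 1 - (1 - m)(1 - l) yields 0 = 1 - (1 - m)², and 0 ≤ m ≤ 1 leaves only m
    -- = 0.
    · have h1 := tendsto_laplace (P := P) hU
      have h2 := (((tendsto_laplace (P := P) hV).const_sub 1).const_mul (1 - m)).const_sub 1
      rw [show (fun n => 1 - (1 - m) * (1 - laplace P V n)) = laplace P U from
        funext fun n => (hUV n).symm] at h2
      have h3 := tendsto_nhds_unique h1 h2
      rw [measureReal_def, h0, ENNReal.toReal_zero] at h3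
      nlinarith
  have hUV' : ∀ n, laplace P U n = laplace P V n := fun n => by
    rw [hUV n, hmzero]; ring
  refine exists_map_eq_expLaw_of_functional_eq hU hV hpos hUV' ?_ h
  rw [← hm, hmzero]
  exact zero_ne_one

lemma exists_expLaw_of_isOrdinary (hT : ∀ i, Measurable (T i)) (hord : IsOrdinary T P)
    (h : ∀ a b : ℕ, laplace P (T 0) (a + b) *
      (laplace P (T 1) a + laplace P (T 1) b - laplace P (T 1) a * laplace P (T 1) b)
        = laplace P (T 0) a * laplace P (T 0) b) :
    ∃ θ : ℝ≥0, 0 < θ ∧ P.map (T 0) = expLaw θ ∧ P.map (T 1) = expLaw θ := by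
  refine exists_map_eq_expLaw_of_functional_eq (hT 0) (hT 1)
    (laplace_pos (hT 0) (hord.non_defective 0))
    (laplace_congr_of_map_eq (hT 0) (hT 1) hord.non_delayed.map_eq) ?_ h
  rw [measureReal_def, hord.no_simultaneous_arrivals 1, ENNReal.toReal_zero]
  exact zero_ne_one

end

end MarkedRenewal

end

theorem theorem1p1 {Ω : Type*} [MeasurableSpace Ω] (P : Measure Ω) [IsProbabilityMeasure P]
    (T : ℕ → Ω → ℝ≥0∞) (X : ℕ → Ω → Fin 2) (p : ℝ) (hp : p ∈ Set.Ioo (0 : ℝ) 1)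
    (hT_meas : ∀ i, Measurable (T i))
    (hT_indep : iIndepFun T P)
    (hT_ident : ∀ j, 1 ≤ j → IdentDistrib (T j) (T 1) P P)
    (hX_meas : ∀ i, Measurable (X i))
    (hX_indep : iIndepFun X P)
    (hX_law : ∀ i, P.real {ω | X i ω = 1} = p)
    (hTX : IndepFun (fun ω i => T i ω) (fun ω i => X i ω) P) :
    ((∀ ε : ℝ≥0, 0 < ε → 0 < P {ω | T 0 ω < (ε : ℝ≥0∞)}) →
      (MarkedRenewal.NonArithmetic (T 1) P ∨ P {ω | T 0 ω = 0} = 0) →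
      (IndepFun (MarkedRenewal.firstEpoch T X 0) (MarkedRenewal.firstEpoch T X 1) P ↔
        ∃ θ : ℝ≥0, MarkedRenewal.IsHPP (MarkedRenewal.renewalProcess T) θ P)) ∧
    (MarkedRenewal.IsOrdinary T P →
      (IndepFun (MarkedRenewal.firstEpoch T X 0) (MarkedRenewal.firstEpoch T X 1) P ↔
        ∃ θ : ℝ≥0, MarkedRenewal.IsHPP (MarkedRenewal.renewalProcess T) θ P)) := by
  rw [MarkedRenewal.indepFun_firstEpoch_iff hp hT_meas hT_indep hT_ident hX_meas hX_indep hX_law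
    hTX, MarkedRenewal.exists_isHPP_iff hT_meas hT_indep hT_ident]
  refine ⟨fun hess hor => ⟨MarkedRenewal.exists_expLaw_of_nonArithmetic_or (hT_meas 0) (hT_meas 1)
    hess hor, ?_⟩, fun hord => ⟨MarkedRenewal.exists_expLaw_of_isOrdinary hT_meas hord, ?_⟩⟩ <;>
  · rintro ⟨θ, hθ, h0, h1⟩
    exact MarkedRenewal.functional_eq_of_map_eq_expLaw (hT_meas 0) (hT_meas 1) hθ h0 h1
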